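/- **Conflict graph.** Let $G=(V,E)$ be a finite graph with $V\neq\emptyset$ that is *mean valid*, characterized by $I_1,\dots,I_d$: $d\ge 2$, the $I_s$ are pairwise disjoint maximal independent sets with union $V$, their cardinalities $M_s=|I_s|$ satisfy $M_1\ge\dots\ge M_d$, and $\sum_{s=1}^d |I\cap I_s|/M_s\le 1$ for every independent set $I$ of $G$. **Market.** There are $l$ primaries (sellers) and $m$ secondaries (buyers) at each node, $1\le m<l$. Independently for each primary, its channel is in state $j\in\{1,\dots,n\}$ at all nodes with probability $q_j>0$, and unavailable (state $0$) at all nodes with probability $1-\sum_{j=1}^n q_j>0$. A channel in state $j$ offered at price $p\ge 0$ has penalty $g_j(p)$, where $g_j:[0,\infty)\to\mathbb R$ is continuous and strictly increasing, and $g_j(p)<g_i(p)$ for $i<j$. Let $f_j$ be the inverse of $g_j$. Selling at a node costs $c\ge 0$; no secondary accepts a penalty above $v$; for each $j$, $v=g_j(p)$ for some $p>c$. Moreover, for $i<j$ and $x>y>g_i(c)$ (with $x$ in the ranges of $g_i$ and $g_j$), $$\frac{f_i(y)-c}{f_j(y)-c}<\frac{f_i(x)-c}{f_j(x)-c}.$$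 **Game.** A strategy of a primary specifies, for each state $j\ge1$ of its own channel, a probability mass function on the independent sets of $G$ and a probability distribution of the penalty (in the range of $g_j$) that it uses at each node of the selected set. At each node, among the channels offered there with penalty at most $v$, the $m$ with lowest penalties (all, if there are fewer) are sold, ties being broken uniformly at random. A primary in state $j$ that offers its channel at a node at penalty $x$ gets $f_j(x)-c$ there if it sells and $0$ otherwise; its payoff is the sum over the nodes of the selected set. A strategy profile is a Nash equilibrium if no primary can, in any state $j\ge1$, increase its expected payoff by changing its strategy unilaterally. **Single-location distribution.** Let $w(x)=\sum_{i=m}^{l-1}\binom{l-1}{i}x^i(1-x)^{l-1-i}$ and $W=1-w$ on $[0,1]$. For $\alpha=(\alpha_1,\dots,\alpha_n)$, $\alpha_k\ge0$, $\sum_k\alpha_k<1$, put $L_0=v$ and, for $j=1,\dots,n$, $$p_j-c=(f_j(L_{j-1})-c)\,W\Big(\sum_{k\ge j}\alpha_k\Big),\qquad L_j=g_j\Big(\frac{p_j-c}{W(\sum_{k>j}\alpha_k)}+c\Big).$$ If $\alpha_j>0$, let $\phi_j^{\alpha}$ be the distribution function with $\phi_j^\alpha(x)=0$ for $x<L_j$,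 $\phi_j^\alpha(x)=1$ for $x>L_{j-1}$, and $$\phi_j^\alpha(x)=\frac1{\alpha_j}\Big(w^{-1}\Big(\frac{f_j(x)-p_j}{f_j(x)-c}\Big)-\sum_{k>j}\alpha_k\Big),\qquad L_j\le x\le L_{j-1}.$$ **Theorem.** (a) There is exactly one family $t=(t_{s,j})_{1\le s\le d,\,1\le j\le n}$ such that, with $\gamma_{s,j}=\sum_{k=j}^n t_{s,k}q_k$, for every $j$ one has $\sum_{s=1}^d t_{s,j}=1$ and there is $d_j\in\{1,\dots,d\}$ with $t_{s,j}>0$ for $s\le d_j$, $t_{s,j}=0$ for $s>d_j$, and $$M_1W(\gamma_{1,j})=\dots=M_{d_j}W(\gamma_{d_j,j})\ge M_{d_j+1}W(\gamma_{d_j+1,j})\ge\dots\ge M_dW(\gamma_{d,j}).$$ (b) For this $t$ there is a strategy which, in each state $j$, selects $I_s$ with probability $t_{s,j}$ (and no other independent set) and, whenever $t_{s,j}>0$, uses at every node of $I_s$ the penalty distribution $\phi_j^{\alpha}$ with $\alpha_k=q_kt_{s,k}$, $k=1,\dots,n$; and if all $l$ primaries use one and the same such strategy, the profile is a Nash equilibrium.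 In particular no primary gains by deviating to any independent set of $G$, whether or not it is one of $I_1,\dots,I_d$, with any penalties. -/

import Mathlib

open Finset MeasureTheory

noncomputable section

namespace SpectrumGame

/-- `I 0, …, I (d-1)` characterize the mean valid graph `G`: they partition the nodes into `d ≥ 2`
maximal independent sets, listed by non-increasing cardinality, and every independent set `J` of `G`
satisfies `∑ s, |J ∩ I s| / |I s| ≤ 1`. -/
structure IsMeanValid {V : Type*} [Fintype V] [DecidableEq V] (G : SimpleGraph V) {d : ℕ}
    (I : Fin d → Finset V) : Prop where
  two_le : 2 ≤ d
  maximal : ∀ s, Maximal (fun J : Finset V => G.IsIndepSet (J : Set V)) (I s)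
  disjoint : ∀ s r, s ≠ r → Disjoint (I s) (I r)
  cover : ∀ a : V, ∃ s, a ∈ I s
  card_antitone : ∀ s r, s ≤ r → (I r).card ≤ (I s).card
  mean : ∀ J : Finset V, G.IsIndepSet (J : Set V) →
    ∑ s, ((J ∩ I s).card : ℝ) / ((I s).card : ℝ) ≤ 1

/-- The data of the market. There are `l` primaries and, at every location, `m` secondaries.
The channel of a primary is unavailable everywhere (state `0`) or is in one of `n` states of
increasing quality everywhere. These `n` states are indexed by `Fin n` in increasing order of
quality: `j : Fin n` stands for the channel state `j + 1`. -/
structure Market (n : ℕ) where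
  /-- number of primaries -/
  l : ℕ
  /-- number of secondaries at each location -/
  m : ℕ
  /-- probability of each of the available channel states -/
  q : Fin n → ℝ
  /-- largest penalty that a secondary accepts -/
  v : ℝ
  /-- cost that a primary incurs at each location where it sells its channel -/
  c : ℝ
  /-- `g j p` is the penalty of a channel in state `j` that is offered at the price `p ≥ 0` -/
  g : Fin n → ℝ → ℝ

namespace Market

variable {n : ℕ} (mk : Market n)

/-- The penalties that a primary can select in state `j`: those of the prices `p ≥ 0`. -/
def penaltySet (j : Fin n) : Set ℝ := mk.g j '' Set.Ici 0

/-- The inverse `f_j` of `g_j`: the price at which a channel in state `j` has penalty `x`. -/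
def price (j : Fin n) (x : ℝ) : ℝ := Function.invFunOn (mk.g j) (Set.Ici 0) x

/-- Standing assumptions on the market. -/
structure IsValid : Prop where
  one_le_m : 1 ≤ mk.m
  m_lt_l : mk.m < mk.l
  q_pos : ∀ j, 0 < mk.q j
  q_sum_lt : ∑ j, mk.q j < 1
  c_nonneg : 0 ≤ mk.c
  g_strictMono : ∀ j, StrictMonoOn (mk.g j) (Set.Ici 0)
  g_continuous : ∀ j, ContinuousOn (mk.g j) (Set.Ici 0)
  /-- At equal prices, a channel of a better state has a smaller penalty. -/
  g_lt : ∀ i j, i < j → ∀ p, 0 ≤ p → mk.g j p < mk.g i p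
  /-- In each state the penalty `v` corresponds to a price that exceeds the cost. -/
  v_mem : ∀ j, mk.v ∈ mk.g j '' Set.Ioi mk.c
  /-- `(f_i(y) - c) / (f_j(y) - c) < (f_i(x) - c) / (f_j(x) - c)` for `i < j` and
  `x > y > g_i(c)`. -/
  ratio_lt : ∀ i j, i < j → ∀ x y, x ∈ mk.penaltySet i → x ∈ mk.penaltySet j →
    mk.g i mk.c < y → y < x →
    (mk.price i y - mk.c) / (mk.price j y - mk.c) < (mk.price i x - mk.c) / (mk.price j x - mk.c)

/-! ### The game -/

/-- What a primary does in channel state `j`: it selects the independent set `J` of the conflict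
graph with probability `sel J`, and having selected `J` it offers its channel at every node `a ∈ J`,
at a random penalty of law `pen J a`. (The values `pen J a` with `a ∉ J` play no role.) -/
structure StateStrategy {V : Type*} [Fintype V] [DecidableEq V] (G : SimpleGraph V)
    (j : Fin n) where
  sel : Finset V → ℝ
  sel_nonneg : ∀ J, 0 ≤ sel J
  sel_sum : ∑ J, sel J = 1
  sel_indep : ∀ J : Finset V, ¬ G.IsIndepSet (J : Set V) → sel J = 0
  pen : Finset V → V → ProbabilityMeasure ℝ
  pen_mem : ∀ J a, ∀ᵐ x ∂(pen J a : Measure ℝ), x ∈ mk.penaltySet j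

/-- A strategy of a primary: its behaviour in each of the available channel states. -/
abbrev Strategy {V : Type*} [Fintype V] [DecidableEq V] (G : SimpleGraph V) :=
  ∀ j : Fin n, StateStrategy mk G j

variable {V : Type*} [Fintype V] [DecidableEq V] {G : SimpleGraph V}

/-- The probability that a primary using `S` offers its channel at node `a` at a penalty in `B`. -/
def offerProb (S : Strategy mk G) (a : V) (B : Set ℝ) : ℝ :=
  ∑ j, mk.q j * ∑ J with a ∈ J, (S j).sel J * ((S j).pen J a : Measure ℝ).real B

/-- The probability that a channel is sold at a node when `A` competing channels have a smaller
penalty and `B` competing channels have the same penalty: `m - A` secondaries (none if `A ≥ m`) are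
left for `B + 1` channels, among which they choose symmetrically. -/
def sellShare (m A B : ℕ) : ℝ := min 1 (((m - A : ℕ) : ℝ) / ((B : ℝ) + 1))

/-- The probability that primary `i` sells its channel at node `a` at the penalty `x`, when the other
primaries independently use their strategies in the profile `S`. The sum is over the set `A` of
competitors that offer a smaller penalty at `a` and the set `B` of those that offer the same penalty
at `a`. Nothing is sold at a penalty above `v`. -/
def sellProb (S : Fin mk.l → Strategy mk G) (i : Fin mk.l) (a : V) (x : ℝ) : ℝ :=
  if x ≤ mk.v then
    ∑ A ∈ (univ.erase i).powerset, ∑ B ∈ (univ.erase i \ A).powerset,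
      (∏ k ∈ A, mk.offerProb (S k) a (Set.Iio x)) *
      (∏ k ∈ B, mk.offerProb (S k) a {x}) *
      (∏ k ∈ (univ.erase i \ A) \ B,
        (1 - mk.offerProb (S k) a (Set.Iio x) - mk.offerProb (S k) a {x})) *
      sellShare mk.m A.card B.card
  else 0

/-- The expected payoff of primary `i` in channel state `j` if it behaves according to `τ` and the
other primaries use their strategies in `S` (`S i` does not enter). -/
def expectedPayoff (S : Fin mk.l → Strategy mk G) (i : Fin mk.l) (j : Fin n)
    (τ : StateStrategy mk G j) : ℝ :=
  ∑ J, τ.sel J * ∑ a ∈ J,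
    ∫ x, (mk.price j x - mk.c) * mk.sellProb S i a x ∂(τ.pen J a : Measure ℝ)

/-- `S` is a Nash equilibrium: in no channel state can a primary increase its expected payoff by
deviating unilaterally. -/
def IsNash (S : Fin mk.l → Strategy mk G) : Prop :=
  ∀ (i : Fin mk.l) (j : Fin n) (τ : StateStrategy mk G j),
    mk.expectedPayoff S i j τ ≤ mk.expectedPayoff S i j (S i j)

/-! ### The single-location penalty distribution -/

/-- The probability of at least `m` successes in `l - 1` independent trials with success
probability `x`. -/
def w (x : ℝ) : ℝ :=
  ∑ i ∈ Icc mk.m (mk.l - 1), ((mk.l - 1).choose i : ℝ) * x ^ i * (1 - x) ^ (mk.l - 1 - i)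

/-- `W = 1 - w`. -/
def W (x : ℝ) : ℝ := 1 - mk.w x

/-- The inverse of `w` on `[0, 1]`. -/
def wInv (y : ℝ) : ℝ := Function.invFunOn mk.w (Set.Icc 0 1) y

/-- The endpoints `L_0 = v`, `L_1`, …, `L_n` when a channel is offered in state `k` with probability
`α k`. State `j : Fin n`, the `(j + 1)`-st state, has the upper endpoint `endpoint α j` and the lower
endpoint `endpoint α (j + 1)`. -/
def endpoint (α : Fin n → ℝ) : ℕ → ℝ
  | 0 => mk.v
  | k + 1 =>
    if h : k < n then
      mk.g ⟨k, h⟩ ((mk.price ⟨k, h⟩ (endpoint α k) - mk.c) * mk.W (∑ i ∈ Ici ⟨k, h⟩, α i) /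
        mk.W (∑ i ∈ Ioi ⟨k, h⟩, α i) + mk.c)
    else endpoint α k

/-- `p_j`, given by `p_j - c = (f_j(U_j) - c) (1 - w(∑_{k ≥ j} α_k))`, where `U_j` is the upper
endpoint of state `j`. -/
def eqPrice (α : Fin n → ℝ) (j : Fin n) : ℝ :=
  mk.c + (mk.price j (mk.endpoint α j) - mk.c) * mk.W (∑ i ∈ Ici j, α i)

/-- The single-location penalty distribution function `φ_j` when a channel is offered in state `k`
with probability `α k`. It is meant for `α j > 0`. -/
def penaltyCDF (α : Fin n → ℝ) (j : Fin n) (x : ℝ) : ℝ :=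
  if x < mk.endpoint α (j + 1) then 0
  else if x ≤ mk.endpoint α j then
    1 / α j *
      (mk.wInv ((mk.price j x - mk.eqPrice α j) / (mk.price j x - mk.c)) - ∑ k ∈ Ioi j, α k)
  else 1

/-! ### The strategy of the theorem -/

/-- The probability that a channel of state `j` or better is offered at a node of the `s`-th set of
the partition, if the sets are selected according to `t`. -/
def gam {d : ℕ} (t : Fin d → Fin n → ℝ) (s : Fin d) (j : Fin n) : ℝ :=
  ∑ k ∈ Ici j, t s k * mk.q k

/-- The conditions on the selection probabilities `t s j` of `I s` in state `j`. In each state the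
sets that are selected with positive probability are those up to an index `e`, the probabilities sum
to `1`, and `|I s| W(γ_{s,j})` is constant for `s ≤ e` and non-increasing in `s`. -/
def IsSelection {d : ℕ} (I : Fin d → Finset V) (t : Fin d → Fin n → ℝ) : Prop :=
  ∀ j : Fin n, ∑ s, t s j = 1 ∧
    ∃ e : Fin d, (∀ s, s ≤ e → 0 < t s j) ∧ (∀ s, e < s → t s j = 0) ∧
      (∀ s r, s ≤ e → r ≤ e →
        ((I s).card : ℝ) * mk.W (mk.gam t s j) = ((I r).card : ℝ) * mk.W (mk.gam t r j)) ∧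
      (∀ s r, s ≤ r →
        ((I r).card : ℝ) * mk.W (mk.gam t r j) ≤ ((I s).card : ℝ) * mk.W (mk.gam t s j))

/-- The strategy `S` selects `I s` in state `j` with probability `t s j`, selects no other
independent set, and at every node of a selected `I s` it uses the single-location penalty
distribution with `q_k t_{s,k}` in place of `q_k`. -/
def Follows {d : ℕ} (I : Fin d → Finset V) (t : Fin d → Fin n → ℝ) (S : Strategy mk G) : Prop :=
  ∀ j : Fin n,
    (∀ s, (S j).sel (I s) = t s j) ∧
    (∀ J, (∀ s, J ≠ I s) → (S j).sel J = 0) ∧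
    (∀ s, 0 < t s j → ∀ a ∈ I s, ∀ x : ℝ,
      ((S j).pen (I s) a : Measure ℝ).real (Set.Iic x) =
        mk.penaltyCDF (fun k => mk.q k * t s k) j x)

end Market

end SpectrumGame

end

/-!
Write `W z` for the probability that fewer than `m` of the `l - 1` competitors make an offer when
each of them does so with probability `z`, and `F_s x` for the probability that a competitor offers
at a node of `I s` at a penalty at most `x`, i.e. the mixture `offerCDF` of the single-location
distributions with weights `α k = q k * t s k`.

*Selection probabilities.* They are found by water filling. In state `j` the probability `γ_{s,j}`
is the solution of `|I s| W(γ_{s,j}) = min(|I s|, y_j)`, where the level `y_j` is determined by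
`∑_s γ_{s,j} = ∑_{k ≥ j} q k`; levels increase with the state, which makes the differences
`γ_{s,j} - γ_{s,j+1} = q j * t s j` nonnegative (`exists_isSelection`). Conversely, in a selection
the sets that are used in a state are also used in all worse ones (`IsSelection.pos_of_le`), so that
`γ_{s,j}` vanishes on the unused sets. Then a larger common value of `|I s| W(γ_{s,j})` means
smaller `γ_{s,j}` for all `s`, and as their sum is prescribed, they are unique (`IsSelection.unique`).

*One location.* The distribution of state `j` makes `(f_j(x) - c) W(F_s x)` equal to `p_j - c` on
its interval `[L_j, L_{j-1}]`. If all states are offered, these intervals are adjacent, and the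
assumption on `(f_i - c) / (f_j - c)` propagates from one interval to the next that in state `j` no
other penalty does better (`IsValid.payoff_le_eqPrice_sub`).

*All locations.* All states are offered on the largest set `I 0`. A set that is used in state `j`
has there the same upper endpoint as `I 0`, hence the same total payoff
(`IsSelection.mul_eqPrice_eq`), and at every acceptable penalty `|I s| W(F_s x) ≤ |I 0| W(F_0 x)`
(`IsSelection.mul_W_offerCDF_le`). So a node of `I s` yields at most the share `1 / |I s|` of the
payoff of `I 0`, for every `s`, and mean validity bounds the payoff of an arbitrary independent set
by that of `I 0`, which is attained by every set that is used.
-/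

namespace SpectrumGame

namespace Market

variable {n : ℕ} {mk : Market n}

/-! ### The binomial tail `w` and its inverse -/

/-- Upper tails of the binomial distribution: differentiation in the success probability
telescopes, so that the derivative is a single Bernstein polynomial. -/
lemma derivative_sum_bernsteinPolynomial {m N : ℕ} (hm : 1 ≤ m) (hN : m ≤ N) :
    Polynomial.derivative (∑ i ∈ Icc m N, bernsteinPolynomial ℝ N i) =
      (N : Polynomial ℝ) * bernsteinPolynomial ℝ (N - 1) (m - 1) := by
  obtain ⟨k, rfl⟩ : ∃ k, m = k + 1 := ⟨m - 1, by omega⟩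
  have hI : Icc (k + 1) N = Ico (k + 1) (N + 1) := by ext; simp
  rw [hI, ← Finset.sum_Ico_add' (fun i => bernsteinPolynomial ℝ N i) k N 1,
    Polynomial.derivative_sum]
  simp only [bernsteinPolynomial.derivative_succ, ← Finset.mul_sum]
  have := Finset.sum_Ico_sub (fun i => -bernsteinPolynomial ℝ (N - 1) i) (show k ≤ N by omega)
  simp only [neg_sub_neg] at this
  rw [this, bernsteinPolynomial.eq_zero_of_lt ℝ (show N - 1 < N by omega)]
  simp

lemma w_eq_eval (x : ℝ) :
    mk.w x = (∑ i ∈ Icc mk.m (mk.l - 1), bernsteinPolynomial ℝ (mk.l - 1) i).eval x := by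
  simp [w, bernsteinPolynomial, Polynomial.eval_finsetSum]

lemma continuous_w : Continuous mk.w := by
  unfold w; fun_prop

namespace IsValid

lemma w_strictMonoOn (h : mk.IsValid) : StrictMonoOn mk.w (Set.Icc 0 1) := by
  refine strictMonoOn_of_deriv_pos (convex_Icc 0 1) continuous_w.continuousOn fun x hx => ?_
  rw [interior_Icc] at hx
  have h1 := h.one_le_m
  have h2 := h.m_lt_l
  rw [show mk.w = fun x => _ from funext w_eq_eval, Polynomial.deriv,
    derivative_sum_bernsteinPolynomial h1 (by omega)]
  have hx1 : 0 < 1 - x := sub_pos.2 hx.2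
  have hx0 := hx.1
  have hl : (0 : ℝ) < ((mk.l - 1 : ℕ) : ℝ) := by exact_mod_cast (by omega : 0 < mk.l - 1)
  have hc : (0 : ℝ) < ((mk.l - 1 - 1).choose (mk.m - 1) : ℝ) := by
    exact_mod_cast Nat.choose_pos (by omega)
  simp only [bernsteinPolynomial, Polynomial.eval_mul, Polynomial.eval_natCast,
    Polynomial.eval_pow, Polynomial.eval_X, Polynomial.eval_sub, Polynomial.eval_one]
  positivity

lemma w_zero (h : mk.IsValid) : mk.w 0 = 0 := by
  refine Finset.sum_eq_zero fun i hi => ?_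
  have := h.one_le_m
  have hi0 : i ≠ 0 := by have := (Finset.mem_Icc.1 hi).1; omega
  simp [hi0]

lemma w_one (h : mk.IsValid) : mk.w 1 = 1 := by
  have := h.m_lt_l
  unfold w
  rw [Finset.sum_eq_single (mk.l - 1)]
  · simp
  · intro i hi hne
    have hne' : mk.l - 1 - i ≠ 0 := by have := (Finset.mem_Icc.1 hi).2; omega
    simp [hne']
  · intro hn
    exact absurd (Finset.mem_Icc.2 ⟨by omega, le_rfl⟩) hn

/-- `W` is the probability of at most `m - 1` successes. -/
lemma W_eq_sum_range (h : mk.IsValid) (x : ℝ) :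
    mk.W x = ∑ i ∈ range mk.m,
      ((mk.l - 1).choose i : ℝ) * x ^ i * (1 - x) ^ (mk.l - 1 - i) := by
  have hm := h.m_lt_l
  have h1 : ∑ i ∈ range (mk.l - 1 + 1),
      ((mk.l - 1).choose i : ℝ) * x ^ i * (1 - x) ^ (mk.l - 1 - i) = 1 := by
    have := add_pow x (1 - x) (mk.l - 1)
    rw [add_sub_cancel, one_pow] at this
    exact (Finset.sum_congr rfl fun i _ => by ring).trans this.symm
  have h2 : Icc mk.m (mk.l - 1) = Ico mk.m (mk.l - 1 + 1) := by ext; simp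
  rw [W, w, h2, sub_eq_iff_eq_add,
    Finset.sum_range_add_sum_Ico _ (show mk.m ≤ mk.l - 1 + 1 by omega), h1]

lemma W_strictAntiOn (h : mk.IsValid) : StrictAntiOn mk.W (Set.Icc 0 1) :=
  fun _ hx _ hy hxy => sub_lt_sub_left (h.w_strictMonoOn hx hy hxy) 1

lemma W_zero (h : mk.IsValid) : mk.W 0 = 1 := by simp [W, h.w_zero]

lemma W_one (h : mk.IsValid) : mk.W 1 = 0 := by simp [W, h.w_one]

lemma W_nonneg (h : mk.IsValid) {x : ℝ} (hx : x ∈ Set.Icc (0 : ℝ) 1) : 0 ≤ mk.W x :=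
  h.W_one ▸ h.W_strictAntiOn.antitoneOn hx (by simp) hx.2

lemma W_le_one (h : mk.IsValid) {x : ℝ} (hx : x ∈ Set.Icc (0 : ℝ) 1) : mk.W x ≤ 1 :=
  h.W_zero ▸ h.W_strictAntiOn.antitoneOn (by simp) hx hx.1

lemma W_pos (h : mk.IsValid) {x : ℝ} (h0 : 0 ≤ x) (h1 : x < 1) : 0 < mk.W x :=
  h.W_one ▸ h.W_strictAntiOn ⟨h0, h1.le⟩ (by simp) h1

lemma wInv_w (h : mk.IsValid) {x : ℝ} (hx : x ∈ Set.Icc (0 : ℝ) 1) : mk.wInv (mk.w x) = x :=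
  h.w_strictMonoOn.injOn.leftInvOn_invFunOn hx

lemma exists_w_eq (h : mk.IsValid) {y : ℝ} (hy : y ∈ Set.Icc (0 : ℝ) 1) :
    ∃ x ∈ Set.Icc (0 : ℝ) 1, mk.w x = y := by
  have := intermediate_value_Icc (zero_le_one' ℝ) (continuous_w (mk := mk)).continuousOn
  rw [h.w_zero, h.w_one] at this
  exact this hy

lemma wInv_mem (h : mk.IsValid) {y : ℝ} (hy : y ∈ Set.Icc (0 : ℝ) 1) :
    mk.wInv y ∈ Set.Icc (0 : ℝ) 1 :=
  Function.invFunOn_mem (h.exists_w_eq hy)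

lemma w_wInv (h : mk.IsValid) {y : ℝ} (hy : y ∈ Set.Icc (0 : ℝ) 1) : mk.w (mk.wInv y) = y :=
  Function.invFunOn_eq (h.exists_w_eq hy)

lemma W_wInv (h : mk.IsValid) {y : ℝ} (hy : y ∈ Set.Icc (0 : ℝ) 1) :
    mk.W (mk.wInv y) = 1 - y := by rw [W, h.w_wInv hy]

lemma wInv_strictMonoOn (h : mk.IsValid) : StrictMonoOn mk.wInv (Set.Icc 0 1) := by
  intro x hx y hy hxy
  rwa [← h.w_strictMonoOn.lt_iff_lt (h.wInv_mem hx) (h.wInv_mem hy), h.w_wInv hx, h.w_wInv hy]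

lemma wInv_continuousOn (h : mk.IsValid) : ContinuousOn mk.wInv (Set.Icc 0 1) := by
  rw [continuousOn_iff_continuous_domRestrict]
  let e : Set.Icc (0 : ℝ) 1 → Set.Icc (0 : ℝ) 1 := fun y => ⟨mk.wInv y, h.wInv_mem y.2⟩
  have hmono : Monotone e := fun x y hxy => h.wInv_strictMonoOn.monotoneOn x.2 y.2 hxy
  have hsurj : Function.Surjective e := fun x => by
    refine ⟨⟨mk.w x, ?_⟩, Subtype.ext (h.wInv_w x.2)⟩
    have := h.w_strictMonoOn.monotoneOn
    exact ⟨h.w_zero.symm.trans_le (this (by simp) x.2 x.2.1),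
      (this x.2 (by simp) x.2.2).trans_eq h.w_one⟩
  exact continuous_subtype_val.comp (hmono.continuous_of_surjective hsurj)

/-! ### Prices and penalties -/

lemma price_g (h : mk.IsValid) (j : Fin n) {p : ℝ} (hp : 0 ≤ p) : mk.price j (mk.g j p) = p :=
  (h.g_strictMono j).injOn.leftInvOn_invFunOn hp

lemma price_nonneg {j : Fin n} {x : ℝ} (hx : x ∈ mk.penaltySet j) : 0 ≤ mk.price j x :=
  Function.invFunOn_mem hx

lemma g_price {j : Fin n} {x : ℝ} (hx : x ∈ mk.penaltySet j) : mk.g j (mk.price j x) = x :=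
  Function.invFunOn_eq hx

lemma price_strictMonoOn (h : mk.IsValid) (j : Fin n) :
    StrictMonoOn (mk.price j) (mk.penaltySet j) := by
  intro x hx y hy hxy
  rwa [← (h.g_strictMono j).lt_iff_lt (price_nonneg hx) (price_nonneg hy), g_price hx, g_price hy]

/-- Penalties between `g j c` and `v` are those of prices above the cost. -/
lemma mem_penaltySet (h : mk.IsValid) {j : Fin n} {x : ℝ} (hx : x ∈ Set.Ioc (mk.g j mk.c) mk.v) :
    x ∈ mk.penaltySet j := by
  obtain ⟨p, hp, hpv⟩ := h.v_mem j
  have hp : mk.c < p := hp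
  have hc := h.c_nonneg
  obtain ⟨y, hy, rfl⟩ := intermediate_value_Icc hp.le
    ((h.g_continuous j).mono fun y hy => hc.trans hy.1) ⟨hx.1.le, hx.2.trans_eq hpv.symm⟩
  exact ⟨y, hc.trans hy.1, rfl⟩

lemma cost_lt_price (h : mk.IsValid) {j : Fin n} {x : ℝ} (hx : x ∈ mk.penaltySet j)
    (hc : mk.g j mk.c < x) : mk.c < mk.price j x := by
  rw [← h.price_g j h.c_nonneg]
  exact h.price_strictMonoOn j ⟨mk.c, h.c_nonneg, rfl⟩ hx hc

lemma price_sub_pos (h : mk.IsValid) {j : Fin n} {x : ℝ} (hx : x ∈ Set.Ioc (mk.g j mk.c) mk.v) :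
    0 < mk.price j x - mk.c :=
  sub_pos.2 (h.cost_lt_price (h.mem_penaltySet hx) hx.1)

lemma v_mem_Ioc (h : mk.IsValid) (j : Fin n) : mk.v ∈ Set.Ioc (mk.g j mk.c) mk.v := by
  obtain ⟨p, hp, hpv⟩ := h.v_mem j
  exact ⟨hpv ▸ h.g_strictMono j h.c_nonneg (h.c_nonneg.trans (le_of_lt hp)) hp, le_rfl⟩

lemma g_cost_le (h : mk.IsValid) {i j : Fin n} (hij : i ≤ j) : mk.g j mk.c ≤ mk.g i mk.c := by
  rcases hij.eq_or_lt with rfl | hij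
  · exact le_rfl
  · exact (h.g_lt i j hij _ h.c_nonneg).le

/-- The comparison of the states `i < j` without division: raising the penalty favours the
worse state `i`. -/
lemma price_mul_le (h : mk.IsValid) {i j : Fin n} (hij : i < j) {x y : ℝ}
    (hy : mk.g i mk.c < y) (hyx : y ≤ x) (hx : x ≤ mk.v) :
    (mk.price i y - mk.c) * (mk.price j x - mk.c) ≤
      (mk.price i x - mk.c) * (mk.price j y - mk.c) := by
  rcases hyx.eq_or_lt with rfl | hyx
  · exact le_rfl
  have hxi : x ∈ Set.Ioc (mk.g i mk.c) mk.v := ⟨hy.trans hyx, hx⟩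
  have hj := h.g_cost_le hij.le
  have hxj : x ∈ Set.Ioc (mk.g j mk.c) mk.v := ⟨hj.trans_lt hxi.1, hx⟩
  have hyj : y ∈ Set.Ioc (mk.g j mk.c) mk.v := ⟨hj.trans_lt hy, hyx.le.trans hx⟩
  have := h.ratio_lt i j hij x y (h.mem_penaltySet hxi) (h.mem_penaltySet hxj) hy hyx
  rw [div_lt_div_iff₀ (h.price_sub_pos hyj) (h.price_sub_pos hxj)] at this
  exact this.le

end IsValid

/-! ### The endpoints of the penalty intervals -/

/-- The probability `∑_{i ≥ k} α i` of an offer in state `k` or better, for `k : ℕ`. -/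
noncomputable def tail (α : Fin n → ℝ) (k : ℕ) : ℝ :=
  ∑ i ∈ univ.filter (fun i : Fin n => k ≤ (i : ℕ)), α i

lemma tail_eq_sum_ite (α : Fin n → ℝ) (k : ℕ) :
    tail α k = ∑ i : Fin n, if k ≤ (i : ℕ) then α i else 0 := Finset.sum_filter _ _

lemma tail_eq_add (α : Fin n → ℝ) (j : Fin n) : tail α j = α j + tail α (j + 1) := by
  rw [tail, tail]
  have : (univ.filter fun i : Fin n => (j : ℕ) ≤ i) =
      insert j (univ.filter fun i : Fin n => (j : ℕ) + 1 ≤ i) := by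
    ext i
    simp only [mem_filter, mem_univ, true_and, mem_insert, Fin.ext_iff]
    omega
  rw [this, Finset.sum_insert (by simp)]

lemma tail_of_le (α : Fin n → ℝ) {k : ℕ} (hk : n ≤ k) : tail α k = 0 :=
  Finset.sum_eq_zero fun i hi => by have := (Finset.mem_filter.1 hi).2; omega

lemma sum_Ici_eq_tail (α : Fin n → ℝ) (j : Fin n) : ∑ i ∈ Ici j, α i = tail α j :=
  Finset.sum_congr (by
    ext i
    simp only [mem_Ici, mem_filter, mem_univ, true_and, Fin.le_def])
    fun _ _ => rfl

lemma sum_Ioi_eq_tail (α : Fin n → ℝ) (j : Fin n) : ∑ i ∈ Ioi j, α i = tail α (j + 1) :=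
  Finset.sum_congr (by
    ext i
    simp only [mem_Ioi, mem_filter, mem_univ, true_and, Fin.lt_def, Nat.succ_le_iff])
    fun _ _ => rfl

/-- Offer probabilities of the states at a node: nonnegative, of total mass less than one. -/
structure IsOfferProfile (α : Fin n → ℝ) : Prop where
  nonneg : ∀ k, 0 ≤ α k
  sum_lt_one : ∑ k, α k < 1

lemma IsOfferProfile.tail_antitone {α : Fin n → ℝ} (hα : IsOfferProfile α) :
    Antitone (tail α) := fun _ _ hab =>
  Finset.sum_le_sum_of_subset_of_nonneg
    (fun i hi => by simp only [mem_filter, mem_univ, true_and] at hi ⊢; omega)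
    fun i _ _ => hα.nonneg i

lemma IsOfferProfile.tail_nonneg {α : Fin n → ℝ} (hα : IsOfferProfile α) (k : ℕ) :
    0 ≤ tail α k := Finset.sum_nonneg fun i _ => hα.nonneg i

lemma IsOfferProfile.tail_lt_one {α : Fin n → ℝ} (hα : IsOfferProfile α) (k : ℕ) :
    tail α k < 1 := by
  refine (hα.tail_antitone (Nat.zero_le k)).trans_lt ?_
  simpa [tail] using hα.sum_lt_one

lemma IsOfferProfile.tail_mem {α : Fin n → ℝ} (hα : IsOfferProfile α) (k : ℕ) :
    tail α k ∈ Set.Icc (0 : ℝ) 1 := ⟨hα.tail_nonneg k, (hα.tail_lt_one k).le⟩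

lemma endpoint_zero (α : Fin n → ℝ) : mk.endpoint α 0 = mk.v := rfl

lemma endpoint_succ (α : Fin n → ℝ) (j : Fin n) :
    mk.endpoint α (j + 1) =
      mk.g j ((mk.price j (mk.endpoint α j) - mk.c) * mk.W (tail α j) /
        mk.W (tail α (j + 1)) + mk.c) := by
  rw [endpoint, dif_pos j.2, ← sum_Ici_eq_tail, ← sum_Ioi_eq_tail]

lemma endpoint_succ_of_le (α : Fin n → ℝ) {k : ℕ} (hk : n ≤ k) :
    mk.endpoint α (k + 1) = mk.endpoint α k := by
  rw [endpoint, dif_neg (by omega)]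

lemma eqPrice_sub (α : Fin n → ℝ) (j : Fin n) :
    mk.eqPrice α j - mk.c = (mk.price j (mk.endpoint α j) - mk.c) * mk.W (tail α j) := by
  rw [eqPrice, sum_Ici_eq_tail]; ring

namespace IsValid

variable {α : Fin n → ℝ}

lemma W_tail_pos (h : mk.IsValid) (hα : IsOfferProfile α) (k : ℕ) : 0 < mk.W (tail α k) :=
  h.W_pos (hα.tail_nonneg k) (hα.tail_lt_one k)

lemma W_tail_mono (h : mk.IsValid) (hα : IsOfferProfile α) {a b : ℕ} (hab : a ≤ b) :
    mk.W (tail α a) ≤ mk.W (tail α b) :=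
  h.W_strictAntiOn.antitoneOn (hα.tail_mem b) (hα.tail_mem a) (hα.tail_antitone hab)

/-- The lower endpoint of state `j` has the price at which a sale against the better states alone
yields `eqPrice α j - c`. -/
lemma price_endpoint_succ (h : mk.IsValid) (hα : IsOfferProfile α) (j : Fin n)
    (hj : mk.endpoint α j ∈ Set.Ioc (mk.g j mk.c) mk.v) :
    mk.price j (mk.endpoint α (j + 1)) - mk.c =
      (mk.price j (mk.endpoint α j) - mk.c) * mk.W (tail α j) / mk.W (tail α (j + 1)) := by
  have h1 := h.price_sub_pos hj
  have h2 := h.W_tail_pos hα j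
  have h3 := h.W_tail_pos hα (j + 1)
  have hc := h.c_nonneg
  rw [endpoint_succ, h.price_g j (by positivity)]
  ring

lemma endpoint_succ_mem (h : mk.IsValid) (hα : IsOfferProfile α) (j : Fin n)
    (hj : mk.endpoint α j ∈ Set.Ioc (mk.g j mk.c) mk.v) :
    mk.endpoint α (j + 1) ∈ Set.Ioc (mk.g j mk.c) (mk.endpoint α j) := by
  have h1 := h.price_sub_pos hj
  have h2 := h.W_tail_pos hα j
  have h3 := h.W_tail_pos hα (j + 1)
  have hc := h.c_nonneg
  have hq : 0 < (mk.price j (mk.endpoint α j) - mk.c) * mk.W (tail α j) /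
        mk.W (tail α (j + 1)) := by positivity
  have hm := (h.g_strictMono j).monotoneOn
  rw [endpoint_succ]
  refine ⟨h.g_strictMono j hc (Set.mem_Ici.2 (by positivity)) (by linarith), ?_⟩
  conv_rhs => rw [← g_price (h.mem_penaltySet hj)]
  refine hm (Set.mem_Ici.2 (by positivity)) (price_nonneg (h.mem_penaltySet hj)) ?_
  rw [← le_sub_iff_add_le, div_le_iff₀ h3]
  exact mul_le_mul_of_nonneg_left (h.W_tail_mono hα (Nat.le_succ _)) h1.le

/-- Both endpoints of the interval of a state at most `j`, as well as the upper endpoint for state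
`j + 1`, are penalties of prices above the cost in state `j`. -/
lemma endpoint_mem (h : mk.IsValid) (hα : IsOfferProfile α) (k : ℕ) (j : Fin n)
    (hk : k ≤ (j : ℕ) + 1) : mk.endpoint α k ∈ Set.Ioc (mk.g j mk.c) mk.v := by
  induction k generalizing j with
  | zero => exact h.v_mem_Ioc j
  | succ k ih =>
    let i : Fin n := ⟨k, by omega⟩
    have hi := ih i (Nat.le_succ _)
    have := h.endpoint_succ_mem hα i hi
    exact ⟨(h.g_cost_le (show i ≤ j from Nat.succ_le_succ_iff.1 hk)).trans_lt this.1,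
      this.2.trans hi.2⟩

lemma endpoint_antitone (h : mk.IsValid) (hα : IsOfferProfile α) :
    Antitone (mk.endpoint α) := by
  refine antitone_nat_of_succ_le fun k => ?_
  rcases lt_or_ge k n with hk | hk
  · exact (h.endpoint_succ_mem hα ⟨k, hk⟩ (h.endpoint_mem hα k ⟨k, hk⟩ (Nat.le_succ _))).2
  · exact (endpoint_succ_of_le α hk).le

lemma eqPrice_sub_pos (h : mk.IsValid) (hα : IsOfferProfile α) (j : Fin n) :
    0 < mk.eqPrice α j - mk.c := by
  rw [eqPrice_sub]
  exact mul_pos (h.price_sub_pos (h.endpoint_mem hα j j (Nat.le_succ _))) (h.W_tail_pos hα j)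

lemma eqPrice_sub_eq (h : mk.IsValid) (hα : IsOfferProfile α) (j : Fin n) :
    mk.eqPrice α j - mk.c =
      (mk.price j (mk.endpoint α (j + 1)) - mk.c) * mk.W (tail α (j + 1)) := by
  rw [h.price_endpoint_succ hα j (h.endpoint_mem hα j j (Nat.le_succ _)), eqPrice_sub,
    div_mul_cancel₀ _ (h.W_tail_pos hα _).ne']

end IsValid
/-! ### The single-location penalty distribution -/

namespace IsValid

variable {α : Fin n → ℝ}

lemma Icc_endpoint_subset (h : mk.IsValid) (hα : IsOfferProfile α) (j : Fin n) {x : ℝ}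
    (hx : x ∈ Set.Icc (mk.endpoint α (j + 1)) (mk.endpoint α j)) :
    x ∈ Set.Ioc (mk.g j mk.c) mk.v :=
  ⟨(h.endpoint_mem hα _ j le_rfl).1.trans_le hx.1,
    hx.2.trans (h.endpoint_mem hα _ j (Nat.le_succ _)).2⟩

/-- On the interval of state `j`, the probability `z` of an offer of a better state or of one of
state `j` at a penalty at most `x` makes the payoff `W z * (price j x - c)` constant. -/
lemma W_penaltyCDF_mul (h : mk.IsValid) (hα : IsOfferProfile α) {j : Fin n} (hj : 0 < α j)
    {x : ℝ} (hx : x ∈ Set.Icc (mk.endpoint α (j + 1)) (mk.endpoint α j)) :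
    α j * mk.penaltyCDF α j x + tail α (j + 1) ∈ Set.Icc (tail α (j + 1)) (tail α j) ∧
      mk.W (α j * mk.penaltyCDF α j x + tail α (j + 1)) * (mk.price j x - mk.c) =
        mk.eqPrice α j - mk.c := by
  have hxm := h.Icc_endpoint_subset hα j hx
  have hf := h.price_sub_pos hxm
  have hLm := h.endpoint_mem hα (j + 1) j le_rfl
  have hUm := h.endpoint_mem hα j j (Nat.le_succ _)
  have hmono := (h.price_strictMonoOn j).monotoneOn
  have hL := hmono (h.mem_penaltySet hLm) (h.mem_penaltySet hxm) hx.1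
  have hU := hmono (h.mem_penaltySet hxm) (h.mem_penaltySet hUm) hx.2
  have e1 := eqPrice_sub (mk := mk) α j
  have e2 := h.eqPrice_sub_eq hα j
  have hW1 := h.W_tail_pos hα j
  have hW2 := h.W_tail_pos hα (j + 1)
  set y := (mk.price j x - mk.eqPrice α j) / (mk.price j x - mk.c) with hy
  have hy' : (1 - y) * (mk.price j x - mk.c) = mk.eqPrice α j - mk.c := by
    rw [hy]; field_simp; ring
  have hy1 : mk.w (tail α (j + 1)) ≤ y := by
    have : (1 - y) ≤ mk.W (tail α (j + 1)) := by
      refine le_of_mul_le_mul_right ?_ hf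
      rw [hy', e2, mul_comm]
      exact mul_le_mul_of_nonneg_left (by linarith) hW2.le
    rw [W] at this; linarith
  have hy2 : y ≤ mk.w (tail α j) := by
    have : mk.W (tail α j) ≤ 1 - y := by
      refine le_of_mul_le_mul_right ?_ hf
      rw [hy', e1, mul_comm]
      exact mul_le_mul_of_nonneg_right (by linarith) hW1.le
    rw [W] at this; linarith
  have m1 := hα.tail_mem (j + 1)
  have m2 := hα.tail_mem j
  have hwmem : ∀ {z}, z ∈ Set.Icc (0 : ℝ) 1 → mk.w z ∈ Set.Icc (0 : ℝ) 1 := fun hz => by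
    have a := h.W_nonneg hz
    have b := h.W_le_one hz
    rw [W] at a b
    constructor <;> linarith
  have hyI : y ∈ Set.Icc (0 : ℝ) 1 := ⟨(hwmem m1).1.trans hy1, hy2.trans (hwmem m2).2⟩
  have key : α j * mk.penaltyCDF α j x + tail α (j + 1) = mk.wInv y := by
    rw [penaltyCDF, if_neg (not_lt.2 hx.1), if_pos hx.2, sum_Ioi_eq_tail]
    field_simp
    ring
  rw [key]
  have hinv := h.wInv_strictMonoOn.monotoneOn
  refine ⟨⟨?_, ?_⟩, by rw [h.W_wInv hyI, hy']⟩
  · rw [← h.wInv_w m1]; exact hinv (hwmem m1) hyI hy1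
  · rw [← h.wInv_w m2]; exact hinv hyI (hwmem m2) hy2

lemma penaltyCDF_eq_of_W (h : mk.IsValid) (hα : IsOfferProfile α) {j : Fin n} (hj : 0 < α j)
    {x z : ℝ} (hx : x ∈ Set.Icc (mk.endpoint α (j + 1)) (mk.endpoint α j))
    (hz : z ∈ Set.Icc (0 : ℝ) 1)
    (hW : mk.W z * (mk.price j x - mk.c) = mk.eqPrice α j - mk.c) :
    α j * mk.penaltyCDF α j x + tail α (j + 1) = z := by
  obtain ⟨hm, hv⟩ := h.W_penaltyCDF_mul hα hj hx
  have hf := h.price_sub_pos (h.Icc_endpoint_subset hα j hx)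
  refine h.W_strictAntiOn.injOn ⟨(hα.tail_nonneg _).trans hm.1, hm.2.trans (hα.tail_mem _).2⟩ hz ?_
  exact mul_right_cancel₀ hf.ne' (hv.trans hW.symm)

lemma penaltyCDF_of_le (h : mk.IsValid) (hα : IsOfferProfile α) {j : Fin n} (hj : 0 < α j)
    {x : ℝ} (hx : x ≤ mk.endpoint α (j + 1)) : mk.penaltyCDF α j x = 0 := by
  rcases hx.lt_or_eq with hx | rfl
  · rw [penaltyCDF, if_pos hx]
  · have := h.penaltyCDF_eq_of_W hα hj ⟨le_rfl, h.endpoint_antitone hα (Nat.le_succ _)⟩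
      (hα.tail_mem (j + 1)) (by rw [mul_comm, ← h.eqPrice_sub_eq hα])
    simpa [hj.ne'] using this

lemma penaltyCDF_of_ge (h : mk.IsValid) (hα : IsOfferProfile α) {j : Fin n} (hj : 0 < α j)
    {x : ℝ} (hx : mk.endpoint α j ≤ x) : mk.penaltyCDF α j x = 1 := by
  have hLU := h.endpoint_antitone hα (Nat.le_succ (j : ℕ))
  rcases hx.lt_or_eq with hx | rfl
  · rw [penaltyCDF, if_neg (not_lt.2 (hLU.trans hx.le)), if_neg (not_le.2 hx)]
  · have := h.penaltyCDF_eq_of_W hα hj ⟨hLU, le_rfl⟩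
      (hα.tail_mem j) (by rw [mul_comm, ← eqPrice_sub])
    rw [tail_eq_add] at this
    have := add_right_cancel this
    exact mul_left_cancel₀ hj.ne' (this.trans (mul_one _).symm)

lemma penaltyCDF_mem (h : mk.IsValid) (hα : IsOfferProfile α) {j : Fin n} (hj : 0 < α j)
    (x : ℝ) : mk.penaltyCDF α j x ∈ Set.Icc (0 : ℝ) 1 := by
  rcases le_total x (mk.endpoint α (j + 1)) with hL | hL
  · simp [h.penaltyCDF_of_le hα hj hL]
  rcases le_total (mk.endpoint α j) x with hU | hU
  · simp [h.penaltyCDF_of_ge hα hj hU]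
  obtain ⟨hm, -⟩ := h.W_penaltyCDF_mul hα hj ⟨hL, hU⟩
  rw [tail_eq_add α j] at hm
  constructor
  · exact nonneg_of_mul_nonneg_right (by linarith [hm.1]) hj
  · exact le_of_mul_le_mul_left (by linarith [hm.2]) hj

lemma penaltyCDF_monotone (h : mk.IsValid) (hα : IsOfferProfile α) {j : Fin n} (hj : 0 < α j) :
    Monotone (mk.penaltyCDF α j) := by
  intro x y hxy
  rcases le_total x (mk.endpoint α (j + 1)) with hL | hL
  · rw [h.penaltyCDF_of_le hα hj hL]; exact (h.penaltyCDF_mem hα hj y).1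
  rcases le_total (mk.endpoint α j) y with hU | hU
  · rw [h.penaltyCDF_of_ge hα hj hU]; exact (h.penaltyCDF_mem hα hj x).2
  have hx : x ∈ Set.Icc (mk.endpoint α (j + 1)) (mk.endpoint α j) := ⟨hL, hxy.trans hU⟩
  have hy : y ∈ Set.Icc (mk.endpoint α (j + 1)) (mk.endpoint α j) := ⟨hL.trans hxy, hU⟩
  obtain ⟨hmx, hvx⟩ := h.W_penaltyCDF_mul hα hj hx
  obtain ⟨hmy, hvy⟩ := h.W_penaltyCDF_mul hα hj hy
  have hxm := h.Icc_endpoint_subset hα j hx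
  have hym := h.Icc_endpoint_subset hα j hy
  have hf := (h.price_strictMonoOn j).monotoneOn (h.mem_penaltySet hxm) (h.mem_penaltySet hym) hxy
  have hpos := h.price_sub_pos hxm
  have hpos' := h.price_sub_pos hym
  have mem : ∀ {z}, z ∈ Set.Icc (tail α (j + 1)) (tail α j) → z ∈ Set.Icc (0 : ℝ) 1 := fun hz =>
    ⟨(hα.tail_nonneg _).trans hz.1, hz.2.trans (hα.tail_mem _).2⟩
  have hWle : mk.W (α j * mk.penaltyCDF α j y + tail α (j + 1)) ≤
      mk.W (α j * mk.penaltyCDF α j x + tail α (j + 1)) := by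
    refine le_of_mul_le_mul_right ?_ hpos'
    rw [hvy, ← hvx]
    exact mul_le_mul_of_nonneg_left (by linarith) (h.W_nonneg (mem hmx))
  have := (h.W_strictAntiOn.le_iff_ge (mem hmy) (mem hmx)).1 hWle
  exact le_of_mul_le_mul_left (by linarith) hj

/-- A monotone function onto an interval has no jumps. -/
lemma penaltyCDF_continuous (h : mk.IsValid) (hα : IsOfferProfile α) {j : Fin n} (hj : 0 < α j) :
    Continuous (mk.penaltyCDF α j) := by
  let e : ℝ → Set.Icc (0 : ℝ) 1 := fun x => ⟨mk.penaltyCDF α j x, h.penaltyCDF_mem hα hj x⟩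
  have hmono : Monotone e := fun x y hxy => h.penaltyCDF_monotone hα hj hxy
  refine continuous_subtype_val.comp (hmono.continuous_of_surjective fun u => ?_)
  obtain ⟨u, hu0, hu1⟩ := u
  -- The quantile of `u` is the penalty at which `W` offsets the price.
  set z := α j * u + tail α (j + 1) with hz
  have hadd := tail_eq_add α j
  have hz0 : tail α (j + 1) ≤ z := by rw [hz]; nlinarith
  have hz1 : z ≤ tail α j := by rw [hz, hadd]; nlinarith
  have hzm : z ∈ Set.Icc (0 : ℝ) 1 :=
    ⟨(hα.tail_nonneg _).trans hz0, hz1.trans (hα.tail_mem _).2⟩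
  have hW := h.W_pos hzm.1 (hz1.trans_lt (hα.tail_lt_one _))
  have hW1 := h.W_strictAntiOn.antitoneOn (hα.tail_mem _) hzm hz0
  have hW2 := h.W_strictAntiOn.antitoneOn hzm (hα.tail_mem _) hz1
  have hp := h.eqPrice_sub_pos hα j
  have hLm := h.mem_penaltySet (h.endpoint_mem hα (j + 1) j le_rfl)
  have hUm := h.mem_penaltySet (h.endpoint_mem hα j j (Nat.le_succ _))
  have hc := h.c_nonneg
  have hr0 : 0 ≤ (mk.eqPrice α j - mk.c) / mk.W z + mk.c := by positivity
  have hpr := h.price_g j hr0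
  have hmono := (h.g_strictMono j).monotoneOn
  have hx : mk.g j ((mk.eqPrice α j - mk.c) / mk.W z + mk.c) ∈
      Set.Icc (mk.endpoint α (j + 1)) (mk.endpoint α j) := by
    constructor
    · rw [← g_price hLm]
      refine hmono (price_nonneg hLm) hr0 ?_
      rw [← sub_le_iff_le_add, le_div_iff₀ hW, h.eqPrice_sub_eq hα]
      exact mul_le_mul_of_nonneg_left hW1
        (h.price_sub_pos (h.endpoint_mem hα (j + 1) j le_rfl)).le
    · rw [← g_price hUm]
      refine hmono hr0 (price_nonneg hUm) ?_
      rw [← le_sub_iff_add_le, div_le_iff₀ hW, eqPrice_sub]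
      exact mul_le_mul_of_nonneg_left hW2
        (h.price_sub_pos (h.endpoint_mem hα j j (Nat.le_succ _))).le
  have := h.penaltyCDF_eq_of_W hα hj hx hzm (by rw [hpr]; field_simp; ring)
  exact ⟨mk.g j ((mk.eqPrice α j - mk.c) / mk.W z + mk.c),
    Subtype.ext (mul_left_cancel₀ hj.ne' (add_right_cancel this))⟩

/-- The single-location penalty distribution as a probability measure. -/
lemma exists_measure_penaltyCDF (h : mk.IsValid) (hα : IsOfferProfile α) {j : Fin n}
    (hj : 0 < α j) :
    ∃ μ : ProbabilityMeasure ℝ, ∀ x, (μ : Measure ℝ).real (Set.Iic x) = mk.penaltyCDF α j x := by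
  let f : StieltjesFunction ℝ :=
    ⟨mk.penaltyCDF α j, h.penaltyCDF_monotone hα hj,
      fun x => (h.penaltyCDF_continuous hα hj).continuousWithinAt⟩
  have hbot : Filter.Tendsto f Filter.atBot (nhds 0) :=
    tendsto_const_nhds.congr' ((Filter.eventually_le_atBot (mk.endpoint α (j + 1))).mono
      fun x hx => (h.penaltyCDF_of_le hα hj hx).symm)
  have htop : Filter.Tendsto f Filter.atTop (nhds 1) :=
    tendsto_const_nhds.congr' ((Filter.eventually_ge_atTop (mk.endpoint α j)).mono
      fun x hx => (h.penaltyCDF_of_ge hα hj hx).symm)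
  refine ⟨⟨f.measure, f.isProbabilityMeasure hbot htop⟩, fun x => ?_⟩
  change (f.measure (Set.Iic x)).toReal = _
  rw [f.measure_Iic hbot, sub_zero, ENNReal.toReal_ofReal (h.penaltyCDF_mem hα hj x).1]

lemma ae_mem_Icc_endpoint (h : mk.IsValid) (hα : IsOfferProfile α) {j : Fin n} (hj : 0 < α j)
    {μ : Measure ℝ} [IsProbabilityMeasure μ]
    (hμ : ∀ x, μ.real (Set.Iic x) = mk.penaltyCDF α j x) :
    ∀ᵐ x ∂μ, x ∈ Set.Icc (mk.endpoint α (j + 1)) (mk.endpoint α j) := by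
  have h0 : μ (Set.Iic (mk.endpoint α (j + 1))) = 0 := by
    rw [← measureReal_eq_zero_iff, hμ, h.penaltyCDF_of_le hα hj le_rfl]
  have h1 : μ (Set.Iic (mk.endpoint α j))ᶜ = 0 := by
    rw [prob_compl_eq_zero_iff measurableSet_Iic, ← ENNReal.toReal_eq_one_iff]
    exact (hμ _).trans (h.penaltyCDF_of_ge hα hj le_rfl)
  filter_upwards [compl_mem_ae_iff.2 h0, mem_ae_iff.2 h1] with x hx hx'
  exact ⟨(not_le.1 (show ¬ x ≤ _ from hx)).le, hx'⟩

lemma measure_singleton_eq_zero (h : mk.IsValid) (hα : IsOfferProfile α) {j : Fin n}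
    (hj : 0 < α j) {μ : Measure ℝ} [IsProbabilityMeasure μ]
    (hμ : ∀ x, μ.real (Set.Iic x) = mk.penaltyCDF α j x) (x : ℝ) : μ {x} = 0 := by
  have hf : (ProbabilityTheory.cdf μ : ℝ → ℝ) = mk.penaltyCDF α j :=
    funext fun x => (ProbabilityTheory.cdf_eq_real μ x).trans (hμ x)
  rw [← ProbabilityTheory.measure_cdf μ, StieltjesFunction.measure_singleton, hf,
    ((h.penaltyCDF_continuous hα hj).continuousAt.continuousWithinAt).leftLim_eq]
  simp

end IsValid
/-! ### The best response at a single location -/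

/-- The probability of an offer at a penalty at most `x`, when state `k` is offered with probability
`α k` at the single-location penalties. -/
noncomputable def offerCDF (mk : Market n) (α : Fin n → ℝ) (x : ℝ) : ℝ :=
  ∑ k, α k * mk.penaltyCDF α k x

namespace IsValid

variable {α : Fin n → ℝ}

lemma offerCDF_monotone (h : mk.IsValid) (hα : IsOfferProfile α) : Monotone (mk.offerCDF α) := by
  refine fun x y hxy => Finset.sum_le_sum fun k _ => ?_
  rcases (hα.nonneg k).eq_or_lt with hk | hk
  · simp [← hk]
  · exact mul_le_mul_of_nonneg_left (h.penaltyCDF_monotone hα hk hxy) hk.le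

lemma offerCDF_mem (h : mk.IsValid) (hα : IsOfferProfile α) (x : ℝ) :
    mk.offerCDF α x ∈ Set.Icc (0 : ℝ) 1 := by
  have key : ∀ k, α k * mk.penaltyCDF α k x ∈ Set.Icc 0 (α k) := fun k => by
    rcases (hα.nonneg k).eq_or_lt with hk | hk
    · simp [← hk]
    · have := h.penaltyCDF_mem hα hk x
      exact ⟨mul_nonneg hk.le this.1, mul_le_of_le_one_right hk.le this.2⟩
  exact ⟨Finset.sum_nonneg fun k _ => (key k).1,
    (Finset.sum_le_sum fun k _ => (key k).2).trans hα.sum_lt_one.le⟩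

/-- On the interval of state `j` the better states are surely cheaper and the worse ones surely
more expensive. -/
lemma offerCDF_eq (h : mk.IsValid) (hα : IsOfferProfile α) {j : Fin n} {x : ℝ}
    (hx : x ∈ Set.Icc (mk.endpoint α (j + 1)) (mk.endpoint α j)) :
    mk.offerCDF α x = α j * mk.penaltyCDF α j x + tail α (j + 1) := by
  have hanti := h.endpoint_antitone hα
  have key : ∀ k, α k * mk.penaltyCDF α k x =
      (if k = j then α k * mk.penaltyCDF α k x else 0) + if (j : ℕ) + 1 ≤ k then α k else 0 := by
    intro k
    rcases (hα.nonneg k).eq_or_lt with hk | hk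
    · simp [← hk]
    rcases lt_trichotomy k j with hkj | rfl | hkj
    · have hkj' : (k : ℕ) + 1 ≤ j := hkj
      rw [h.penaltyCDF_of_le hα hk (hx.2.trans (hanti hkj')), if_neg hkj.ne, if_neg (by omega)]
      ring
    · simp
    · have hkj' : (j : ℕ) + 1 ≤ k := hkj
      rw [h.penaltyCDF_of_ge hα hk ((hanti hkj').trans hx.1), if_neg hkj.ne', if_pos hkj']
      ring
  rw [offerCDF, Finset.sum_congr rfl fun k _ => key k, Finset.sum_add_distrib, ← tail_eq_sum_ite]
  simp

lemma offerCDF_of_le (h : mk.IsValid) (hα : IsOfferProfile α) {x : ℝ}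
    (hx : x ≤ mk.endpoint α n) : mk.offerCDF α x = 0 := by
  refine Finset.sum_eq_zero fun k _ => ?_
  rcases (hα.nonneg k).eq_or_lt with hk | hk
  · simp [← hk]
  · have hkn : (k : ℕ) + 1 ≤ n := k.2
    rw [h.penaltyCDF_of_le hα hk (hx.trans (h.endpoint_antitone hα hkn)), mul_zero]

/-- In state `j` all penalties in the interval of that state yield `eqPrice α j - c`. -/
lemma W_offerCDF_mul (h : mk.IsValid) (hα : IsOfferProfile α) {j : Fin n} (hj : 0 < α j) {x : ℝ}
    (hx : x ∈ Set.Icc (mk.endpoint α (j + 1)) (mk.endpoint α j)) :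
    mk.W (mk.offerCDF α x) * (mk.price j x - mk.c) = mk.eqPrice α j - mk.c := by
  rw [h.offerCDF_eq hα hx, (h.W_penaltyCDF_mul hα hj hx).2]

lemma W_offerCDF_anti (h : mk.IsValid) (hα : IsOfferProfile α) {x y : ℝ} (hxy : x ≤ y) :
    mk.W (mk.offerCDF α y) ≤ mk.W (mk.offerCDF α x) :=
  h.W_strictAntiOn.antitoneOn (h.offerCDF_mem hα x) (h.offerCDF_mem hα y)
    (h.offerCDF_monotone hα hxy)

lemma W_offerCDF_nonneg (h : mk.IsValid) (hα : IsOfferProfile α) (x : ℝ) :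
    0 ≤ mk.W (mk.offerCDF α x) := h.W_nonneg (h.offerCDF_mem hα x)

end IsValid

/-- If a payoff `w₁ b₁ = w₂ b₂` is equal at two penalties in one state, then another state whose
margins `a₁`, `a₂` satisfy `a₁ / b₁ ≤ a₂ / b₂` prefers the second penalty. -/
lemma mul_le_mul_of_cross {a₁ a₂ b₁ b₂ w₁ w₂ : ℝ} (hb₁ : 0 < b₁) (hb₂ : 0 < b₂) (hw : 0 ≤ w₂)
    (hab : a₁ * b₂ ≤ a₂ * b₁) (hwb : w₁ * b₁ = w₂ * b₂) : a₁ * w₁ ≤ a₂ * w₂ := by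
  refine le_of_mul_le_mul_right ?_ (mul_pos hb₁ hb₂)
  calc a₁ * w₁ * (b₁ * b₂) = a₁ * b₂ * (w₁ * b₁) := by ring
    _ = (a₁ * b₂) * (w₂ * b₂) := by rw [hwb]
    _ ≤ (a₂ * b₁) * (w₂ * b₂) := mul_le_mul_of_nonneg_right hab (mul_nonneg hw hb₂.le)
    _ = a₂ * w₂ * (b₁ * b₂) := by ring

namespace IsValid

variable {α : Fin n → ℝ}

/-- Penalties below the interval of state `j` are no better in state `j` than its lower endpoint:
on the interval of a better state `k` the payoff of state `k` is constant, and the worse state `j`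
gains more than `k` does from a higher penalty. -/
lemma payoff_le_of_le_endpoint (h : mk.IsValid) (hα : IsOfferProfile α) (hpos : ∀ k, 0 < α k)
    {j : Fin n} {x : ℝ} (hx : mk.g j mk.c < x) (hxL : x ≤ mk.endpoint α (j + 1)) :
    (mk.price j x - mk.c) * mk.W (mk.offerCDF α x) ≤ mk.eqPrice α j - mk.c := by
  have hanti := h.endpoint_antitone hα
  have hL : mk.endpoint α (j + 1) ∈ Set.Icc (mk.endpoint α (j + 1)) (mk.endpoint α j) :=
    ⟨le_rfl, hanti (Nat.le_succ _)⟩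
  have above : ∀ k : ℕ, (j : ℕ) + 1 ≤ k → k ≤ n → ∀ x, mk.g j mk.c < x →
      mk.endpoint α k ≤ x → x ≤ mk.endpoint α (j + 1) →
      (mk.price j x - mk.c) * mk.W (mk.offerCDF α x) ≤ mk.eqPrice α j - mk.c := by
    intro k hk
    induction k, hk using Nat.le_induction with
    | base =>
      intro _ x hx h1 h2
      obtain rfl := le_antisymm h1 h2
      rw [mul_comm, h.W_offerCDF_mul hα (hpos j) hL]
    | succ k hk ih =>
      intro hkn x hx h1 h2
      rcases le_total (mk.endpoint α k) x with hxk | hxk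
      · exact ih (by omega) x hx hxk h2
      have hjn := j.2
      let i : Fin n := ⟨k, by omega⟩
      have hji : j < i := hk
      have hU : mk.endpoint α k ∈ Set.Icc (mk.endpoint α ((i : ℕ) + 1)) (mk.endpoint α i) :=
        ⟨hanti (Nat.le_succ _), le_rfl⟩
      have hxi : x ∈ Set.Icc (mk.endpoint α ((i : ℕ) + 1)) (mk.endpoint α i) := ⟨h1, hxk⟩
      have hUv := (h.Icc_endpoint_subset hα i hU).2
      refine le_trans ?_ (ih (by omega) _ (hx.trans_le hxk) le_rfl (hanti hk))
      refine mul_le_mul_of_cross (h.price_sub_pos (h.Icc_endpoint_subset hα i hxi))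
        (h.price_sub_pos (h.Icc_endpoint_subset hα i hU)) (h.W_offerCDF_nonneg hα _)
        (h.price_mul_le hji hx hxk hUv) ?_
      rw [h.W_offerCDF_mul hα (hpos i) hxi, h.W_offerCDF_mul hα (hpos i) hU]
  rcases le_total (mk.endpoint α n) x with hxn | hxn
  · exact above n j.2 le_rfl x hx hxn hxL
  · -- Below all offers a sale is certain, and the price increases with the penalty.
    refine le_trans ?_ (above n j.2 le_rfl _ (hx.trans_le hxn) le_rfl (hanti j.2))
    have hnm := (h.endpoint_mem hα (j + 1) j le_rfl).2
    have hn := (hanti (show (j : ℕ) + 1 ≤ n from j.2)).trans hnm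
    rw [h.offerCDF_of_le hα hxn, h.offerCDF_of_le hα le_rfl, h.W_zero, mul_one, mul_one]
    exact sub_le_sub_right ((h.price_strictMonoOn j).monotoneOn
      (h.mem_penaltySet ⟨hx, hxn.trans hn⟩) (h.mem_penaltySet ⟨hx.trans_le hxn, hn⟩) hxn) _

/-- Penalties above the interval of state `j` are no better in state `j` than its upper endpoint. -/
lemma payoff_le_of_endpoint_le (h : mk.IsValid) (hα : IsOfferProfile α) (hpos : ∀ k, 0 < α k)
    {j : Fin n} {x : ℝ} (hxU : mk.endpoint α j ≤ x) (hxv : x ≤ mk.v) :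
    (mk.price j x - mk.c) * mk.W (mk.offerCDF α x) ≤ mk.eqPrice α j - mk.c := by
  have hanti := h.endpoint_antitone hα
  have hU : mk.endpoint α j ∈ Set.Icc (mk.endpoint α (j + 1)) (mk.endpoint α j) :=
    ⟨hanti (Nat.le_succ _), le_rfl⟩
  have below : ∀ i k : ℕ, k + i = j → ∀ x, mk.endpoint α j ≤ x → x ≤ mk.endpoint α k →
      (mk.price j x - mk.c) * mk.W (mk.offerCDF α x) ≤ mk.eqPrice α j - mk.c := by
    intro i
    induction i with
    | zero =>
      intro k hk x h1 h2
      obtain rfl : k = j := hk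
      obtain rfl := le_antisymm h1 h2
      rw [mul_comm, h.W_offerCDF_mul hα (hpos j) hU]
    | succ i ih =>
      intro k hk x h1 h2
      rcases le_total x (mk.endpoint α (k + 1)) with hxk | hxk
      · exact ih (k + 1) (by omega) x h1 hxk
      have hjn := j.2
      let r : Fin n := ⟨k, by omega⟩
      have hrj : r < j := Fin.lt_def.2 (show k < (j : ℕ) by omega)
      have hL : mk.endpoint α (k + 1) ∈ Set.Icc (mk.endpoint α ((r : ℕ) + 1)) (mk.endpoint α r) :=
        ⟨le_rfl, hanti (Nat.le_succ _)⟩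
      have hxr : x ∈ Set.Icc (mk.endpoint α ((r : ℕ) + 1)) (mk.endpoint α r) := ⟨hxk, h2⟩
      have hLm := h.Icc_endpoint_subset hα r hL
      have hxm := h.Icc_endpoint_subset hα r hxr
      refine le_trans ?_ (ih (k + 1) (by omega) _ (hanti (by omega)) le_rfl)
      refine mul_le_mul_of_cross (h.price_sub_pos hxm) (h.price_sub_pos hLm)
        (h.W_offerCDF_nonneg hα _) ?_ ?_
      · have := h.price_mul_le hrj hLm.1 hxk hxm.2
        linarith
      · rw [h.W_offerCDF_mul hα (hpos r) hxr, h.W_offerCDF_mul hα (hpos r) hL]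
  exact below j 0 (by omega) x hxU hxv

/-- If all states are offered, then in state `j` no penalty yields more than `eqPrice α j - c`
against competitors that use the single-location penalties. -/
theorem payoff_le_eqPrice_sub (h : mk.IsValid) (hα : IsOfferProfile α) (hpos : ∀ k, 0 < α k)
    {j : Fin n} {x : ℝ} (hx : x ∈ mk.penaltySet j) (hxv : x ≤ mk.v) :
    (mk.price j x - mk.c) * mk.W (mk.offerCDF α x) ≤ mk.eqPrice α j - mk.c := by
  rcases le_or_gt x (mk.g j mk.c) with hxc | hxc
  · have hc : mk.price j x ≤ mk.c := by
      rw [← h.price_g j h.c_nonneg]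
      exact (h.price_strictMonoOn j).monotoneOn hx ⟨mk.c, h.c_nonneg, rfl⟩ hxc
    exact (mul_nonpos_of_nonpos_of_nonneg (by linarith) (h.W_offerCDF_nonneg hα x)).trans
      (h.eqPrice_sub_pos hα j).le
  rcases le_total x (mk.endpoint α (j + 1)) with hL | hL
  · exact h.payoff_le_of_le_endpoint hα hpos hxc hL
  rcases le_total (mk.endpoint α j) x with hU | hU
  · exact h.payoff_le_of_endpoint_le hα hpos hU hxv
  · rw [mul_comm, h.W_offerCDF_mul hα (hpos j) ⟨hL, hU⟩]

end IsValid
end Market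
end SpectrumGame

namespace SpectrumGame

lemma IsMeanValid.card_pos {V : Type*} [Fintype V] [DecidableEq V] [Nonempty V]
    {G : SimpleGraph V} {d : ℕ} {I : Fin d → Finset V} (hI : IsMeanValid G I) (s : Fin d) :
    0 < ((I s).card : ℝ) := by
  rw [Nat.cast_pos, Finset.card_pos]
  by_contra hne
  rw [Finset.not_nonempty_iff_eq_empty] at hne
  obtain ⟨a⟩ := ‹Nonempty V›
  -- A single node would properly extend the empty set.
  have := (hI.maximal s).2 (y := {a}) (by simp) (by simp [hne])
  simp [hne] at this

namespace Market

variable {n : ℕ} {mk : Market n}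

/-! ### The selection probabilities: existence -/

lemma tail_eq_of_telescoping {α : Fin n → ℝ} {Γ : ℕ → ℝ}
    (hα : ∀ j : Fin n, α j = Γ j - Γ (j + 1)) (hn : Γ n = 0) {k : ℕ} (hk : k ≤ n) :
    tail α k = Γ k := by
  induction hk using Nat.decreasingInduction with
  | self => rw [tail_of_le α le_rfl, hn]
  | of_succ k hk ih =>
    have := tail_eq_add α ⟨k, hk⟩
    rw [this, hα]
    simp only [ih]
    ring

lemma gam_eq_tail {d : ℕ} (t : Fin d → Fin n → ℝ) (s : Fin d) (j : Fin n) :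
    mk.gam t s j = tail (fun k => mk.q k * t s k) j := by
  rw [← sum_Ici_eq_tail, gam]
  exact Finset.sum_congr rfl fun k _ => mul_comm _ _

/-- The solution `x` of `M * W x = min M y`: the offer probability that lowers the value of a set of
`M` nodes to the level `y`, or zero if the set is not worth more than `y`. -/
noncomputable def fill (mk : Market n) (M y : ℝ) : ℝ := mk.wInv (1 - min 1 (y / M))

namespace IsValid

lemma one_sub_min_mem {M y : ℝ} (hM : 0 < M) (hy : 0 ≤ y) :
    1 - min 1 (y / M) ∈ Set.Icc (0 : ℝ) 1 := by
  have : 0 ≤ min 1 (y / M) := le_min zero_le_one (div_nonneg hy hM.le)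
  exact ⟨sub_nonneg.2 (min_le_left _ _), by linarith⟩

lemma fill_mem (h : mk.IsValid) {M y : ℝ} (hM : 0 < M) (hy : 0 ≤ y) :
    mk.fill M y ∈ Set.Icc (0 : ℝ) 1 := h.wInv_mem (one_sub_min_mem hM hy)

lemma mul_W_fill (h : mk.IsValid) {M y : ℝ} (hM : 0 < M) (hy : 0 ≤ y) :
    M * mk.W (mk.fill M y) = min M y := by
  rw [fill, h.W_wInv (one_sub_min_mem hM hy), sub_sub_cancel, mul_min_of_nonneg _ _ hM.le, mul_one,
    mul_div_cancel₀ _ hM.ne']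

lemma fill_of_le (h : mk.IsValid) {M y : ℝ} (hM : 0 < M) (hy : M ≤ y) : mk.fill M y = 0 := by
  rw [fill, min_eq_left ((one_le_div hM).2 hy), sub_self]
  conv_lhs => rw [← h.w_zero]
  exact h.wInv_w (by simp)

lemma fill_zero (h : mk.IsValid) (M : ℝ) : mk.fill M 0 = 1 := by
  rw [fill, zero_div, min_eq_right zero_le_one, sub_zero]
  conv_lhs => rw [← h.w_one]
  exact h.wInv_w (by simp)

lemma fill_le_fill_iff (h : mk.IsValid) {M x y : ℝ} (hM : 0 < M) (hx : 0 ≤ x) (hy : 0 ≤ y) :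
    mk.fill M y ≤ mk.fill M x ↔ min M x ≤ min M y := by
  rw [← h.mul_W_fill hM hx, ← h.mul_W_fill hM hy, mul_le_mul_iff_right₀ hM,
    h.W_strictAntiOn.le_iff_ge (h.fill_mem hM hx) (h.fill_mem hM hy)]

lemma fill_continuousOn (h : mk.IsValid) {M : ℝ} (hM : 0 < M) :
    ContinuousOn (mk.fill M) (Set.Ici 0) :=
  h.wInv_continuousOn.comp (Continuous.continuousOn (by fun_prop)) fun _ hy => one_sub_min_mem hM hy

/-- Water filling: some common level makes the offer probabilities sum to a prescribed value. -/
lemma exists_sum_fill_eq (h : mk.IsValid) {d : ℕ} (hd : 0 < d) {M : Fin d → ℝ}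
    (hM : ∀ s, 0 < M s) (hanti : Antitone M) {Q : ℝ} (hQ : Q ∈ Set.Icc (0 : ℝ) 1) :
    ∃ y, 0 ≤ y ∧ ∑ s, mk.fill (M s) y = Q := by
  have hM0 := hM ⟨0, hd⟩
  have hcont : ContinuousOn (fun y => ∑ s, mk.fill (M s) y) (Set.Icc 0 (M ⟨0, hd⟩)) :=
    continuousOn_finsetSum _ fun s _ => (h.fill_continuousOn (hM s)).mono fun y hy => hy.1
  have h0 : ∑ s, mk.fill (M s) 0 = d := by simp [h.fill_zero]
  have h1 : ∑ s, mk.fill (M s) (M ⟨0, hd⟩) = 0 :=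
    Finset.sum_eq_zero fun s _ => h.fill_of_le (hM s) (hanti (Nat.zero_le _))
  have hd1 : (1 : ℝ) ≤ d := by exact_mod_cast hd
  obtain ⟨y, hy, hyQ⟩ := intermediate_value_Icc' hM0.le hcont
    (show Q ∈ Set.Icc _ _ by rw [h1, h0]; exact ⟨hQ.1, hQ.2.trans hd1⟩)
  exact ⟨y, hy.1, hyQ⟩

lemma isOfferProfile_q (h : mk.IsValid) : IsOfferProfile mk.q :=
  ⟨fun k => (h.q_pos k).le, h.q_sum_lt⟩

theorem exists_isSelection (h : mk.IsValid) {V : Type*} [Fintype V] [DecidableEq V] [Nonempty V]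
    {G : SimpleGraph V} {d : ℕ} {I : Fin d → Finset V} (hI : IsMeanValid G I) :
    ∃ t : Fin d → Fin n → ℝ, mk.IsSelection I t := by
  have hd : 0 < d := by have := hI.two_le; omega
  have hM := hI.card_pos
  have hanti : Antitone fun s => ((I s).card : ℝ) := fun s r hsr =>
    Nat.cast_le.2 (hI.card_antitone s r hsr)
  have hq := h.isOfferProfile_q
  choose y hy0 hy using fun k => h.exists_sum_fill_eq hd hM hanti (hq.tail_mem k)
  set Γ : Fin d → ℕ → ℝ := fun s k => mk.fill (I s).card (y k) with hΓ
  have hΓ0 : ∀ s k, 0 ≤ Γ s k := fun s k => (h.fill_mem (hM s) (hy0 k)).1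
  have hΓn : ∀ s, Γ s n = 0 := fun s => by
    have := hy n
    rw [tail_of_le _ le_rfl] at this
    exact (Finset.sum_eq_zero_iff_of_nonneg fun s _ => hΓ0 s n).1 this s (mem_univ s)
  have hW : ∀ s k, ((I s).card : ℝ) * mk.W (Γ s k) = min ((I s).card : ℝ) (y k) :=
    fun s k => h.mul_W_fill (hM s) (hy0 k)
  have hq_add := tail_eq_add mk.q
  have hlt : ∀ j : Fin n, y j < y (j + 1) := fun j => by
    by_contra! hle
    have hsum : ∑ s, Γ s j ≤ ∑ s, Γ s (j + 1) := Finset.sum_le_sum fun s _ =>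
      (h.fill_le_fill_iff (hM s) (hy0 _) (hy0 _)).2 (min_le_min_left _ hle)
    rw [hy, hy, hq_add] at hsum
    linarith [h.q_pos j]
  have hpos : ∀ s (j : Fin n), y j < (I s).card → Γ s (j + 1) < Γ s j := fun s j hj => by
    rw [← not_le, h.fill_le_fill_iff (hM s) (hy0 _) (hy0 _), not_le, min_eq_right hj.le]
    exact lt_min hj (hlt j)
  have hzero : ∀ s (j : Fin n), (I s).card ≤ y j → Γ s j = 0 ∧ Γ s (j + 1) = 0 := fun s j hj =>
    ⟨h.fill_of_le (hM s) hj, h.fill_of_le (hM s) (hj.trans (hlt j).le)⟩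
  refine ⟨fun s j => (Γ s j - Γ s (j + 1)) / mk.q j, fun j => ⟨?_, ?_⟩⟩
  · rw [← Finset.sum_div, Finset.sum_sub_distrib, hy, hy, hq_add, add_sub_cancel_right,
      div_self (h.q_pos j).ne']
  have hgam : ∀ s, mk.gam (fun s j => (Γ s j - Γ s (j + 1)) / mk.q j) s j = Γ s j := fun s => by
    rw [gam_eq_tail]
    refine tail_eq_of_telescoping (fun k => ?_) (hΓn s) j.2.le
    exact mul_div_cancel₀ _ (h.q_pos k).ne'
  have hne : (univ.filter fun s : Fin d => y j < (I s).card).Nonempty := by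
    refine ⟨⟨0, hd⟩, Finset.mem_filter.2 ⟨mem_univ _, ?_⟩⟩
    by_contra! hle
    have hsum := hy j
    rw [Finset.sum_eq_zero fun s _ =>
      h.fill_of_le (hM s) ((hanti (Nat.zero_le (s : ℕ))).trans hle), hq_add] at hsum
    linarith [h.q_pos j, hq.tail_nonneg (j + 1)]
  -- The sets selected in state `j` are those worth more than the water level of state `j`.
  have hmem : ∀ s, s ≤ Finset.max' _ hne → y j < (I s).card := fun s hs =>
    ((Finset.mem_filter.1 (Finset.max'_mem _ hne)).2).trans_le (hanti hs)
  refine ⟨Finset.max' _ hne, fun s hs => ?_, fun s hs => ?_, fun s r hs hr => ?_, fun s r hsr => ?_⟩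
  · exact div_pos (sub_pos.2 (hpos s j (hmem s hs))) (h.q_pos j)
  · have hle : ((I s).card : ℝ) ≤ y j := by
      by_contra! hlt
      exact hs.not_ge (Finset.le_max' _ s (Finset.mem_filter.2 ⟨mem_univ _, hlt⟩))
    simp only [hzero s j hle, sub_self, zero_div]
  · rw [hgam, hgam, hW, hW, min_eq_right (hmem s hs).le, min_eq_right (hmem r hr).le]
  · rw [hgam, hgam, hW, hW]
    exact min_le_min_right _ (hanti hsr)

end IsValid

/-! ### The selection probabilities: uniqueness -/

namespace IsSelection

variable {V : Type*} {d : ℕ} {I : Fin d → Finset V} {t : Fin d → Fin n → ℝ}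

lemma nonneg (ht : mk.IsSelection I t) (s : Fin d) (j : Fin n) : 0 ≤ t s j := by
  obtain ⟨-, e, hpos, hzero, -⟩ := ht j
  rcases le_or_gt s e with hs | hs
  · exact (hpos s hs).le
  · exact (hzero s hs).ge

lemma pos_zero (ht : mk.IsSelection I t) (hd : 0 < d) (j : Fin n) : 0 < t ⟨0, hd⟩ j := by
  obtain ⟨-, e, hpos, -⟩ := ht j
  exact hpos _ (Nat.zero_le _)

lemma isOfferProfile (ht : mk.IsSelection I t) (h : mk.IsValid) (s : Fin d) :
    IsOfferProfile fun k => mk.q k * t s k := by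
  refine ⟨fun k => mul_nonneg (h.q_pos k).le (ht.nonneg s k), lt_of_le_of_lt ?_ h.q_sum_lt⟩
  refine Finset.sum_le_sum fun k _ => mul_le_of_le_one_right (h.q_pos k).le ?_
  rw [← (ht k).1]
  exact Finset.single_le_sum (f := fun s => t s k) (fun r _ => ht.nonneg r k) (mem_univ s)

lemma mul_W_eq (ht : mk.IsSelection I t) (hd : 0 < d) {s : Fin d} {j : Fin n} (hs : 0 < t s j) :
    ((I s).card : ℝ) * mk.W (tail (fun k => mk.q k * t s k) j) =
      ((I ⟨0, hd⟩).card : ℝ) * mk.W (tail (fun k => mk.q k * t ⟨0, hd⟩ k) j) := by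
  obtain ⟨-, e, -, hzero, heq, -⟩ := ht j
  rw [← gam_eq_tail, ← gam_eq_tail]
  refine heq s _ (not_lt.1 fun hlt => ?_) (Nat.zero_le _)
  exact hs.ne' (hzero s hlt)

lemma mul_W_le (ht : mk.IsSelection I t) (h : mk.IsValid) (hd : 0 < d)
    (hcard : ∀ s r, s ≤ r → (I r).card ≤ (I s).card) (s : Fin d) (k : ℕ) :
    ((I s).card : ℝ) * mk.W (tail (fun k => mk.q k * t s k) k) ≤
      ((I ⟨0, hd⟩).card : ℝ) * mk.W (tail (fun k => mk.q k * t ⟨0, hd⟩ k) k) := by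
  rcases lt_or_ge k n with hk | hk
  · obtain ⟨-, e, -, -, -, hle⟩ := ht ⟨k, hk⟩
    have := hle ⟨0, hd⟩ s (Nat.zero_le _)
    rwa [gam_eq_tail, gam_eq_tail] at this
  · rw [tail_of_le _ hk, tail_of_le _ hk, h.W_zero, mul_one, mul_one]
    exact_mod_cast hcard _ s (Nat.zero_le _)

/-- A set selected in some state is selected in the next worse state: otherwise its value would stay
put while that of the largest set drops. -/
lemma pos_of_succ (ht : mk.IsSelection I t) (h : mk.IsValid) (hd : 0 < d)
    (hpos : ∀ s, 0 < ((I s).card : ℝ)) {s : Fin d} {j k : Fin n} (hjk : (k : ℕ) = j + 1)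
    (hk : 0 < t s k) : 0 < t s j := by
  by_contra hj
  have hj0 : t s j = 0 := le_antisymm (not_lt.1 hj) (ht.nonneg s j)
  have h0 := ht.isOfferProfile h ⟨0, hd⟩
  have hs := tail_eq_add (fun k => mk.q k * t s k) j
  have hs0 := tail_eq_add (fun k => mk.q k * t ⟨0, hd⟩ k) j
  rw [← hjk] at hs hs0
  simp only [hj0, mul_zero, zero_add] at hs
  have hlt : mk.W (tail (fun k => mk.q k * t ⟨0, hd⟩ k) j) <
      mk.W (tail (fun k => mk.q k * t ⟨0, hd⟩ k) k) := by
    refine h.W_strictAntiOn (h0.tail_mem _) (h0.tail_mem _) ?_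
    rw [hs0]
    exact lt_add_of_pos_left _ (mul_pos (h.q_pos j) (ht.pos_zero hd j))
  obtain ⟨-, e, -, -, -, hle⟩ := ht j
  have h1 := hle ⟨0, hd⟩ s (Nat.zero_le _)
  rw [gam_eq_tail, gam_eq_tail, hs, ht.mul_W_eq hd hk] at h1
  exact absurd (le_of_mul_le_mul_left h1 (hpos _)) (not_le.2 hlt)

lemma pos_of_le (ht : mk.IsSelection I t) (h : mk.IsValid) (hd : 0 < d)
    (hpos : ∀ s, 0 < ((I s).card : ℝ)) {s : Fin d} {j k : Fin n} (hjk : j ≤ k)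
    (hk : 0 < t s k) : 0 < t s j := by
  have key : ∀ i : ℕ, ∀ k : Fin n, (k : ℕ) = j + i → 0 < t s k → 0 < t s j := by
    intro i
    induction i with
    | zero => intro k hk ht'; rwa [← Fin.ext (show (k : ℕ) = j from hk)]
    | succ i ih =>
      intro k hk ht'
      have hkn := k.2
      exact ih ⟨j + i, by omega⟩ rfl (ht.pos_of_succ h hd hpos hk ht')
  exact key (k - j) k (by have : (j : ℕ) ≤ k := hjk; omega) hk

lemma tail_eq_zero (ht : mk.IsSelection I t) (h : mk.IsValid) (hd : 0 < d)
    (hpos : ∀ s, 0 < ((I s).card : ℝ)) {s : Fin d} {j : Fin n} (hj : t s j = 0) :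
    tail (fun k => mk.q k * t s k) j = 0 := by
  refine Finset.sum_eq_zero fun k hk => ?_
  have hjk : j ≤ k := (Finset.mem_filter.1 hk).2
  have : t s k = 0 := by
    by_contra hne
    exact (ht.pos_of_le h hd hpos hjk ((ht.nonneg s k).lt_of_ne' hne)).ne' hj
  simp [this]

lemma sum_tail (ht : mk.IsSelection I t) (k : ℕ) :
    ∑ s, tail (fun k => mk.q k * t s k) k = tail mk.q k := by
  simp only [tail]
  rw [Finset.sum_comm]
  refine Finset.sum_congr rfl fun j _ => ?_
  rw [← Finset.mul_sum, (ht j).1, mul_one]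

/-- A higher common value goes with fewer offers in every set. -/
lemma tail_le_tail {t' : Fin d → Fin n → ℝ} (ht : mk.IsSelection I t)
    (ht' : mk.IsSelection I t') (h : mk.IsValid) (hd : 0 < d)
    (hpos : ∀ s, 0 < ((I s).card : ℝ)) (hcard : ∀ s r, s ≤ r → (I r).card ≤ (I s).card)
    {j : Fin n}
    (hle : ((I ⟨0, hd⟩).card : ℝ) * mk.W (tail (fun k => mk.q k * t ⟨0, hd⟩ k) j) ≤
      ((I ⟨0, hd⟩).card : ℝ) * mk.W (tail (fun k => mk.q k * t' ⟨0, hd⟩ k) j)) (s : Fin d) :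
    tail (fun k => mk.q k * t' s k) j ≤ tail (fun k => mk.q k * t s k) j := by
  have hs := ht.isOfferProfile h s
  rcases (ht'.nonneg s j).eq_or_lt with hj | hj
  · rw [ht'.tail_eq_zero h hd hpos hj.symm]
    exact hs.tail_nonneg _
  · have h1 := ((ht.mul_W_le h hd hcard s j).trans hle).trans_eq (ht'.mul_W_eq hd hj).symm
    exact (h.W_strictAntiOn.le_iff_ge (hs.tail_mem _) ((ht'.isOfferProfile h s).tail_mem _)).1
      (le_of_mul_le_mul_left h1 (hpos s))

theorem unique {t' : Fin d → Fin n → ℝ} (ht : mk.IsSelection I t)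
    (ht' : mk.IsSelection I t') (h : mk.IsValid) (hd : 0 < d)
    (hpos : ∀ s, 0 < ((I s).card : ℝ)) (hcard : ∀ s r, s ≤ r → (I r).card ≤ (I s).card) :
    t = t' := by
  -- The tails over all sets have the same sum, so that comparable tails are equal.
  have key : ∀ s (k : ℕ), tail (fun k => mk.q k * t s k) k = tail (fun k => mk.q k * t' s k) k := by
    intro s k
    rcases lt_or_ge k n with hk | hk
    · have hsum := (ht.sum_tail k).trans (ht'.sum_tail k).symm
      rcases le_total
          (((I ⟨0, hd⟩).card : ℝ) * mk.W (tail (fun k => mk.q k * t ⟨0, hd⟩ k) k))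
          (((I ⟨0, hd⟩).card : ℝ) * mk.W (tail (fun k => mk.q k * t' ⟨0, hd⟩ k) k)) with hle | hle
      · have hall := ht.tail_le_tail (j := ⟨k, hk⟩) ht' h hd hpos hcard hle
        exact ((Finset.sum_eq_sum_iff_of_le fun s _ => hall s).1 hsum.symm s (mem_univ s)).symm
      · have hall := ht'.tail_le_tail (j := ⟨k, hk⟩) ht h hd hpos hcard hle
        exact (Finset.sum_eq_sum_iff_of_le fun s _ => hall s).1 hsum s (mem_univ s)
    · rw [tail_of_le _ hk, tail_of_le _ hk]
  funext s j
  have h1 := tail_eq_add (fun k => mk.q k * t s k) j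
  rw [key s j, key s (j + 1), tail_eq_add] at h1
  exact (mul_left_cancel₀ (h.q_pos j).ne' (add_right_cancel h1)).symm

end IsSelection
/-! ### Comparison of the sets of the partition -/

namespace IsValid

variable {α : Fin n → ℝ}

lemma offerCDF_of_ge (h : mk.IsValid) (hα : IsOfferProfile α) {x : ℝ} (hx : mk.v ≤ x) :
    mk.offerCDF α x = tail α 0 := by
  rw [tail_eq_sum_ite]
  refine Finset.sum_congr rfl fun k _ => ?_
  rcases (hα.nonneg k).eq_or_lt with hk | hk
  · simp [← hk]
  · rw [h.penaltyCDF_of_ge hα hk ((h.endpoint_mem hα k k (Nat.le_succ _)).2.trans hx)]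
    simp

lemma endpoint_succ_of_eq_zero (h : mk.IsValid) (hα : IsOfferProfile α) {j : Fin n}
    (hj : α j = 0) : mk.endpoint α (j + 1) = mk.endpoint α j := by
  have hm := h.endpoint_mem hα j j (Nat.le_succ _)
  rw [endpoint_succ, tail_eq_add, hj, zero_add, mul_div_cancel_right₀ _ (h.W_tail_pos hα _).ne',
    sub_add_cancel, g_price (h.mem_penaltySet hm)]

/-- The intervals of the states that are offered cover the penalties between the lowest endpoint
and `v`. -/
lemma exists_mem_Icc_endpoint (h : mk.IsValid) (hα : IsOfferProfile α) {x : ℝ}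
    (hn : mk.endpoint α n < x) (hv : x ≤ mk.v) :
    ∃ j : Fin n, 0 < α j ∧ x ∈ Set.Icc (mk.endpoint α (j + 1)) (mk.endpoint α j) := by
  have key : ∀ k ≤ n, mk.endpoint α k < x →
      ∃ j : Fin n, mk.endpoint α (j + 1) < x ∧ x ≤ mk.endpoint α j := by
    intro k
    induction k with
    | zero => exact fun _ hlt => absurd hlt (not_lt.2 hv)
    | succ k ih =>
      intro hk hlt
      rcases lt_or_ge (mk.endpoint α k) x with hx | hx
      · exact ih (by omega) hx
      · exact ⟨⟨k, hk⟩, hlt, hx⟩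
  obtain ⟨j, h1, h2⟩ := key n le_rfl hn
  refine ⟨j, (hα.nonneg j).lt_of_ne' fun h0 => ?_, h1.le, h2⟩
  rw [h.endpoint_succ_of_eq_zero hα h0] at h1
  exact absurd h1 (not_lt.2 h2)

end IsValid

namespace IsSelection

variable {V : Type*} {d : ℕ} {I : Fin d → Finset V} {t : Fin d → Fin n → ℝ}

/-- The upper endpoint of a state is the same for all sets that are selected in that state. -/
lemma endpoint_eq (ht : mk.IsSelection I t) (h : mk.IsValid) (hd : 0 < d)
    (hpos : ∀ s, 0 < ((I s).card : ℝ)) {s : Fin d} {j : Fin n} (hj : 0 < t s j) :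
    mk.endpoint (fun k => mk.q k * t s k) j =
      mk.endpoint (fun k => mk.q k * t ⟨0, hd⟩ k) j := by
  obtain ⟨k, hk⟩ := j
  induction k with
  | zero => rfl
  | succ k ih =>
    have hk' : k < n := by omega
    have hs := ht.isOfferProfile h s
    have h0 := ht.isOfferProfile h ⟨0, hd⟩
    have hj' : 0 < t s ⟨k, hk'⟩ :=
      ht.pos_of_le h hd hpos (Fin.mk_le_mk.2 (Nat.le_succ k)) hj
    have e1 := ht.mul_W_eq hd hj'
    have e2 := ht.mul_W_eq hd hj
    have hi := ih hk' hj'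
    have hend := endpoint_succ (mk := mk) (fun k => mk.q k * t s k) ⟨k, hk'⟩
    have hend0 := endpoint_succ (mk := mk) (fun k => mk.q k * t ⟨0, hd⟩ k) ⟨k, hk'⟩
    simp only at e1 e2 hi hend hend0
    rw [hend, hend0, hi]
    have p1 := h.W_tail_pos hs (k + 1)
    have p2 := h.W_tail_pos h0 (k + 1)
    have hdiv : mk.W (tail (fun k => mk.q k * t s k) k) /
          mk.W (tail (fun k => mk.q k * t s k) (k + 1)) =
        mk.W (tail (fun k => mk.q k * t ⟨0, hd⟩ k) k) /
          mk.W (tail (fun k => mk.q k * t ⟨0, hd⟩ k) (k + 1)) := by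
      rw [← mul_div_mul_left _ _ (hpos s).ne', e1, e2, mul_div_mul_left _ _ (hpos _).ne']
    rw [mul_div_assoc, mul_div_assoc, hdiv]

/-- All sets that are selected in a state have the same equilibrium payoff in that state. -/
lemma mul_eqPrice_eq (ht : mk.IsSelection I t) (h : mk.IsValid) (hd : 0 < d)
    (hpos : ∀ s, 0 < ((I s).card : ℝ)) {s : Fin d} {j : Fin n} (hj : 0 < t s j) :
    ((I s).card : ℝ) * (mk.eqPrice (fun k => mk.q k * t s k) j - mk.c) =
      ((I ⟨0, hd⟩).card : ℝ) * (mk.eqPrice (fun k => mk.q k * t ⟨0, hd⟩ k) j - mk.c) := by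
  rw [eqPrice_sub, eqPrice_sub, ht.endpoint_eq h hd hpos hj, mul_left_comm, ht.mul_W_eq hd hj]
  ring

lemma endpoint_succ_le (ht : mk.IsSelection I t) (h : mk.IsValid) (hd : 0 < d)
    (hpos : ∀ s, 0 < ((I s).card : ℝ)) (hcard : ∀ s r, s ≤ r → (I r).card ≤ (I s).card)
    {s : Fin d} {j : Fin n} (hj : 0 < t s j) :
    mk.endpoint (fun k => mk.q k * t ⟨0, hd⟩ k) (j + 1) ≤
      mk.endpoint (fun k => mk.q k * t s k) (j + 1) := by
  have hs := ht.isOfferProfile h s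
  have h0 := ht.isOfferProfile h ⟨0, hd⟩
  have e := ht.mul_eqPrice_eq h hd hpos hj
  have ms := h.endpoint_mem hs (j + 1) j le_rfl
  have m0 := h.endpoint_mem h0 (j + 1) j le_rfl
  rw [h.eqPrice_sub_eq hs, h.eqPrice_sub_eq h0] at e
  by_contra! hlt
  have hp := h.price_strictMonoOn j (h.mem_penaltySet ms) (h.mem_penaltySet m0) hlt
  have hle := ht.mul_W_le h hd hcard s (j + 1)
  have hW := mul_pos (hpos ⟨0, hd⟩) (h.W_tail_pos h0 (j + 1))
  have h1 := mul_le_mul_of_nonneg_left hle (h.price_sub_pos ms).le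
  have h2 := mul_lt_mul_of_pos_right (sub_lt_sub_right hp mk.c) hW
  linarith

lemma Icc_endpoint_subset (ht : mk.IsSelection I t) (h : mk.IsValid) (hd : 0 < d)
    (hpos : ∀ s, 0 < ((I s).card : ℝ)) (hcard : ∀ s r, s ≤ r → (I r).card ≤ (I s).card)
    {s : Fin d} {j : Fin n} (hj : 0 < t s j) :
    Set.Icc (mk.endpoint (fun k => mk.q k * t s k) (j + 1))
        (mk.endpoint (fun k => mk.q k * t s k) j) ⊆
      Set.Icc (mk.endpoint (fun k => mk.q k * t ⟨0, hd⟩ k) (j + 1))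
        (mk.endpoint (fun k => mk.q k * t ⟨0, hd⟩ k) j) :=
  Set.Icc_subset_Icc (ht.endpoint_succ_le h hd hpos hcard hj) (ht.endpoint_eq h hd hpos hj).le

lemma mul_W_tail_le (ht : mk.IsSelection I t) (h : mk.IsValid) (hd : 0 < d)
    (hpos : ∀ s, 0 < ((I s).card : ℝ)) (hcard : ∀ s r, s ≤ r → (I r).card ≤ (I s).card)
    (s : Fin d) {k : ℕ} (hk : k ≤ n) :
    ((I s).card : ℝ) * mk.W (tail (fun k => mk.q k * t s k) k) ≤
      ((I ⟨0, hd⟩).card : ℝ) * mk.W (mk.offerCDF (fun k => mk.q k * t ⟨0, hd⟩ k)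
        (mk.endpoint (fun k => mk.q k * t s k) k)) := by
  have hs := ht.isOfferProfile h s
  have h0 := ht.isOfferProfile h ⟨0, hd⟩
  induction k with
  | zero =>
    rw [h.offerCDF_of_ge h0 (endpoint_zero _).ge]
    exact ht.mul_W_le h hd hcard s 0
  | succ k ih =>
    let j : Fin n := ⟨k, hk⟩
    rcases (ht.nonneg s j).eq_or_lt with hj | hj
    · have hz : (fun k => mk.q k * t s k) j = 0 := by simp [← hj]
      have e1 := h.endpoint_succ_of_eq_zero hs hz
      have e2 := tail_eq_add (fun k => mk.q k * t s k) j
      rw [← hj, mul_zero, zero_add] at e2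
      have := ih (by omega)
      rwa [show tail (fun k => mk.q k * t s k) k = _ from e2,
        ← show _ = mk.endpoint (fun k => mk.q k * t s k) k from e1] at this
    · have hx : mk.endpoint (fun k => mk.q k * t s k) (j + 1) ∈
          Set.Icc (mk.endpoint (fun k => mk.q k * t s k) (j + 1))
            (mk.endpoint (fun k => mk.q k * t s k) j) :=
        ⟨le_rfl, h.endpoint_antitone hs (Nat.le_succ _)⟩
      have hf := h.price_sub_pos (h.Icc_endpoint_subset hs j hx)
      have e0 := h.W_offerCDF_mul h0 (mul_pos (h.q_pos j) (ht.pos_zero hd j))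
        (ht.Icc_endpoint_subset h hd hpos hcard hj hx)
      have e := ht.mul_eqPrice_eq h hd hpos hj
      rw [h.eqPrice_sub_eq hs, ← e0] at e
      refine (mul_right_cancel₀ hf.ne' ?_).le
      linear_combination e

/-- At every acceptable penalty the expected number of sales is largest on the largest set. This
reduces deviations to the other sets to deviations on the largest one. -/
theorem mul_W_offerCDF_le (ht : mk.IsSelection I t) (h : mk.IsValid) (hd : 0 < d)
    (hpos : ∀ s, 0 < ((I s).card : ℝ)) (hcard : ∀ s r, s ≤ r → (I r).card ≤ (I s).card)
    (s : Fin d) {x : ℝ} (hx : x ≤ mk.v) :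
    ((I s).card : ℝ) * mk.W (mk.offerCDF (fun k => mk.q k * t s k) x) ≤
      ((I ⟨0, hd⟩).card : ℝ) * mk.W (mk.offerCDF (fun k => mk.q k * t ⟨0, hd⟩ k) x) := by
  have hs := ht.isOfferProfile h s
  have h0 := ht.isOfferProfile h ⟨0, hd⟩
  rcases le_or_gt x (mk.endpoint (fun k => mk.q k * t s k) n) with hn | hn
  · have := ht.mul_W_tail_le h hd hpos hcard s le_rfl
    rw [tail_of_le _ le_rfl] at this
    rw [h.offerCDF_of_le hs hn]
    exact this.trans (mul_le_mul_of_nonneg_left (h.W_offerCDF_anti h0 hn) (hpos _).le)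
  · obtain ⟨j, hj, hxj⟩ := h.exists_mem_Icc_endpoint hs hn hx
    have htj : 0 < t s j := pos_of_mul_pos_right hj (h.q_pos j).le
    have hf := h.price_sub_pos (h.Icc_endpoint_subset hs j hxj)
    have e0 := h.W_offerCDF_mul h0 (mul_pos (h.q_pos j) (ht.pos_zero hd j))
      (ht.Icc_endpoint_subset h hd hpos hcard htj hxj)
    have e := ht.mul_eqPrice_eq h hd hpos htj
    rw [← h.W_offerCDF_mul hs hj hxj, ← e0] at e
    refine (mul_right_cancel₀ hf.ne' ?_).le
    linear_combination e

end IsSelection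
/-! ### The probability of a sale against a symmetric profile -/

section Nash

variable {V : Type*} [Fintype V] [DecidableEq V] {G : SimpleGraph V}

/-- Without ties, a channel is sold if and only if fewer than `m` competitors are cheaper. -/
lemma IsValid.sellProb_const (h : mk.IsValid) (S : mk.Strategy G) (i : Fin mk.l) (a : V) {x : ℝ}
    (hx : mk.offerProb S a {x} = 0) :
    mk.sellProb (fun _ => S) i a x =
      if x ≤ mk.v then mk.W (mk.offerProb S a (Set.Iio x)) else 0 := by
  have hm1 := h.one_le_m
  have hml := h.m_lt_l
  rw [sellProb]
  refine if_congr Iff.rfl ?_ rfl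
  set F := mk.offerProb S a (Set.Iio x)
  have hcard : (univ.erase i).card = mk.l - 1 := by simp
  have hterm : ∀ A ∈ (univ.erase i).powerset,
      ∑ B ∈ (univ.erase i \ A).powerset,
        (∏ _k ∈ A, F) * (∏ _k ∈ B, mk.offerProb S a {x}) *
        (∏ _k ∈ (univ.erase i \ A) \ B, (1 - F - mk.offerProb S a {x})) *
        sellShare mk.m A.card B.card =
      F ^ A.card * (1 - F) ^ (mk.l - 1 - A.card) * if A.card < mk.m then 1 else 0 := by
    intro A hA
    rw [Finset.sum_eq_single ∅]
    · rw [hx, sub_zero, Finset.prod_empty, mul_one, Finset.sdiff_empty, Finset.prod_const,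
        Finset.prod_const, Finset.card_sdiff_of_subset (Finset.mem_powerset.1 hA), hcard]
      congr 1
      rw [sellShare, Finset.card_empty, Nat.cast_zero, zero_add, div_one]
      split_ifs with hlt
      · exact min_eq_left (by exact_mod_cast (by omega : 1 ≤ mk.m - A.card))
      · rw [show mk.m - A.card = 0 by omega, Nat.cast_zero, min_eq_right zero_le_one]
    · intro B _ hB
      obtain ⟨b, hb⟩ := nonempty_iff_ne_empty.2 hB
      rw [hx, Finset.prod_eq_zero (s := B) hb rfl]
      ring
    · exact fun hn => absurd (Finset.empty_mem_powerset _) hn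
  rw [Finset.sum_congr rfl hterm, Finset.sum_powerset_apply_card
    (fun k => F ^ k * (1 - F) ^ (mk.l - 1 - k) * if k < mk.m then (1 : ℝ) else 0), hcard,
    h.W_eq_sum_range, ← Finset.sum_range_add_sum_Ico _ (show mk.m ≤ mk.l - 1 + 1 by omega),
    Finset.sum_eq_zero (s := Ico _ _), add_zero]
  · refine Finset.sum_congr rfl fun k hk => ?_
    rw [if_pos (Finset.mem_range.1 hk), nsmul_eq_mul]
    ring
  · intro k hk
    rw [if_neg (not_lt.2 (Finset.mem_Ico.1 hk).1), mul_zero, smul_zero]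

variable {d : ℕ} {I : Fin d → Finset V} {t : Fin d → Fin n → ℝ}

lemma _root_.SpectrumGame.IsMeanValid.eq_of_mem (hI : IsMeanValid G I) {a : V} {s r : Fin d}
    (hs : a ∈ I s) (hr : a ∈ I r) : s = r := by
  by_contra hne
  exact Finset.disjoint_left.1 (hI.disjoint s r hne) hs hr

lemma Follows.offerProb_eq {S : mk.Strategy G} (hS : mk.Follows I t S) (hI : IsMeanValid G I)
    {s : Fin d} {a : V} (ha : a ∈ I s) (B : Set ℝ) :
    mk.offerProb S a B =
      ∑ j, mk.q j * t s j * (((S j).pen (I s) a : Measure ℝ).real B) := by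
  refine Finset.sum_congr rfl fun j _ => ?_
  obtain ⟨hsel, hother, -⟩ := hS j
  rw [Finset.sum_eq_single (I s), hsel, mul_assoc]
  · intro J hJ hne
    rw [hother J, zero_mul]
    rintro r rfl
    exact hne (by rw [hI.eq_of_mem ha (Finset.mem_filter.1 hJ).2])
  · exact fun hn => (hn (Finset.mem_filter.2 ⟨mem_univ _, ha⟩)).elim

/-- At the nodes of `I s` a channel offered at penalty `x` is sold with the single-location
probability for the offer probabilities `q k * t s k`. -/
lemma Follows.sellProb_eq {S : mk.Strategy G} (hS : mk.Follows I t S) (hI : IsMeanValid G I)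
    (h : mk.IsValid) (ht : mk.IsSelection I t) {s : Fin d} {a : V} (ha : a ∈ I s)
    (i : Fin mk.l) (x : ℝ) :
    mk.sellProb (fun _ => S) i a x =
      if x ≤ mk.v then mk.W (mk.offerCDF (fun k => mk.q k * t s k) x) else 0 := by
  have hα := ht.isOfferProfile h s
  have hsing : ∀ j, 0 < t s j → ((S j).pen (I s) a : Measure ℝ) {x} = 0 := fun j hj =>
    h.measure_singleton_eq_zero hα (mul_pos (h.q_pos j) hj) ((hS j).2.2 s hj a ha) x
  have h0 : mk.offerProb S a {x} = 0 := by
    rw [hS.offerProb_eq hI ha]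
    refine Finset.sum_eq_zero fun j _ => ?_
    rcases (ht.nonneg s j).eq_or_lt with hj | hj
    · simp [← hj]
    · rw [measureReal_def, hsing j hj, ENNReal.toReal_zero, mul_zero]
  have h1 : mk.offerProb S a (Set.Iio x) = mk.offerCDF (fun k => mk.q k * t s k) x := by
    rw [hS.offerProb_eq hI ha]
    refine Finset.sum_congr rfl fun j _ => ?_
    rcases (ht.nonneg s j).eq_or_lt with hj | hj
    · simp [← hj]
    · rw [← (hS j).2.2 s hj a ha x, measureReal_def, measureReal_def,
        measure_congr (Iio_ae_eq_Iic' (hsing j hj))]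
  rw [h.sellProb_const S i a h0, h1]

/-! ### The equilibrium -/

/-- Mean validity: nodes of `I s` worth `y / |I s|` make an independent set worth at most `y`. -/
lemma _root_.SpectrumGame.IsMeanValid.sum_div_card_le (hI : IsMeanValid G I) {idx : V → Fin d}
    (hidx : ∀ a, a ∈ I (idx a)) {J : Finset V} (hJ : G.IsIndepSet (J : Set V)) {y : ℝ}
    (hy : 0 ≤ y) : ∑ a ∈ J, y / (I (idx a)).card ≤ y := by
  rw [← Finset.sum_fiberwise J idx]
  calc ∑ s, ∑ a ∈ J with idx a = s, y / (I (idx a)).card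
      = ∑ s, ((J ∩ I s).card : ℝ) / (I s).card * y := by
        refine Finset.sum_congr rfl fun s _ => ?_
        have hf : J.filter (fun a => idx a = s) = J ∩ I s := by
          ext a
          rw [Finset.mem_filter, Finset.mem_inter]
          exact and_congr_right fun _ => ⟨fun e => e ▸ hidx a, fun e => hI.eq_of_mem (hidx a) e⟩
        rw [← hf, Finset.sum_congr rfl fun a ha => by rw [(Finset.mem_filter.1 ha).2],
          Finset.sum_const, nsmul_eq_mul]
        ring
    _ ≤ 1 * y := by
        rw [← Finset.sum_mul]
        exact mul_le_mul_of_nonneg_right (hI.mean J hJ) hy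
    _ = y := one_mul y

/-- The payoff in state `j` of selecting the largest set `I 0` and offering at its single-location
penalties, which is the equilibrium payoff. -/
noncomputable def value (mk : Market n) (I : Fin d → Finset V) (t : Fin d → Fin n → ℝ)
    (hd : 0 < d) (j : Fin n) : ℝ :=
  ((I ⟨0, hd⟩).card : ℝ) * (mk.eqPrice (fun k => mk.q k * t ⟨0, hd⟩ k) j - mk.c)

variable [Nonempty V]

/-- No penalty in state `j` yields more at a node of `I s` than the share `1 / |I s|` of the
equilibrium payoff. -/
lemma Follows.payoff_le {S : mk.Strategy G} (hS : mk.Follows I t S) (hI : IsMeanValid G I)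
    (h : mk.IsValid) (ht : mk.IsSelection I t) (hd : 0 < d) {s : Fin d} {a : V} (ha : a ∈ I s)
    (i : Fin mk.l) {j : Fin n} {x : ℝ} (hx : x ∈ mk.penaltySet j) :
    (mk.price j x - mk.c) * mk.sellProb (fun _ => S) i a x ≤ mk.value I t hd j / (I s).card := by
  have hpos := hI.card_pos
  have h0 := ht.isOfferProfile h ⟨0, hd⟩
  have hs := ht.isOfferProfile h s
  have hall : ∀ k, 0 < mk.q k * t ⟨0, hd⟩ k := fun k => mul_pos (h.q_pos k) (ht.pos_zero hd k)
  have hval : 0 ≤ mk.value I t hd j := mul_nonneg (hpos _).le (h.eqPrice_sub_pos h0 j).le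
  have hval' : 0 ≤ mk.value I t hd j / (I s).card := div_nonneg hval (hpos s).le
  rw [hS.sellProb_eq hI h ht ha]
  split_ifs with hxv
  · rcases le_or_gt (mk.price j x - mk.c) 0 with hf | hf
    · exact (mul_nonpos_of_nonpos_of_nonneg hf (h.W_offerCDF_nonneg hs x)).trans hval'
    rw [le_div_iff₀ (hpos s), value]
    have h1 := mul_le_mul_of_nonneg_left
      (ht.mul_W_offerCDF_le h hd hpos hI.card_antitone s hxv) hf.le
    have h2 := mul_le_mul_of_nonneg_left
      (h.payoff_le_eqPrice_sub h0 hall hx hxv) (hpos ⟨0, hd⟩).le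
    linarith
  · rw [mul_zero]
    exact hval'

/-- A set used in state `j` gives each of its nodes an equal share of the equilibrium payoff, at
every penalty in the interval of that state. -/
lemma Follows.payoff_eq {S : mk.Strategy G} (hS : mk.Follows I t S) (hI : IsMeanValid G I)
    (h : mk.IsValid) (ht : mk.IsSelection I t) (hd : 0 < d) {s : Fin d} {a : V} (ha : a ∈ I s)
    (i : Fin mk.l) {j : Fin n} (hj : 0 < t s j) {x : ℝ}
    (hx : x ∈ Set.Icc (mk.endpoint (fun k => mk.q k * t s k) (j + 1))
      (mk.endpoint (fun k => mk.q k * t s k) j)) :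
    (mk.price j x - mk.c) * mk.sellProb (fun _ => S) i a x = mk.value I t hd j / (I s).card := by
  have hs := ht.isOfferProfile h s
  rw [hS.sellProb_eq hI h ht ha, if_pos (h.Icc_endpoint_subset hs j hx).2, mul_comm,
    h.W_offerCDF_mul hs (mul_pos (h.q_pos j) hj) hx, value,
    ← ht.mul_eqPrice_eq h hd hI.card_pos hj, mul_div_cancel_left₀ _ (hI.card_pos s).ne']

theorem Follows.expectedPayoff_le {S : mk.Strategy G} (hS : mk.Follows I t S)
    (hI : IsMeanValid G I) (h : mk.IsValid) (ht : mk.IsSelection I t) (hd : 0 < d)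
    (i : Fin mk.l) (j : Fin n) (τ : StateStrategy mk G j) :
    mk.expectedPayoff (fun _ => S) i j τ ≤ mk.value I t hd j := by
  choose idx hidx using hI.cover
  have h0 := ht.isOfferProfile h ⟨0, hd⟩
  have hval : 0 ≤ mk.value I t hd j :=
    mul_nonneg (hI.card_pos _).le (h.eqPrice_sub_pos h0 j).le
  have hnode : ∀ J a, ∫ x, (mk.price j x - mk.c) * mk.sellProb (fun _ => S) i a x
      ∂(τ.pen J a : Measure ℝ) ≤ mk.value I t hd j / (I (idx a)).card := by
    intro J a
    have hae := (τ.pen_mem J a).mono fun x hx => hS.payoff_le hI h ht hd (hidx a) i hx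
    by_cases hint : Integrable (fun x => (mk.price j x - mk.c) * mk.sellProb (fun _ => S) i a x)
        (τ.pen J a : Measure ℝ)
    · refine (integral_mono_ae hint (integrable_const _) hae).trans_eq ?_
      simp
    · -- The integral of a payoff that is not integrable is zero by convention.
      rw [integral_undef hint]
      exact div_nonneg hval (hI.card_pos _).le
  calc mk.expectedPayoff (fun _ => S) i j τ
      ≤ ∑ J, τ.sel J * mk.value I t hd j := by
        refine Finset.sum_le_sum fun J _ => ?_
        by_cases hJ : G.IsIndepSet (J : Set V)
        · exact mul_le_mul_of_nonneg_left ((Finset.sum_le_sum fun a _ => hnode J a).trans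
            (hI.sum_div_card_le hidx hJ hval)) (τ.sel_nonneg J)
        · rw [τ.sel_indep J hJ, zero_mul, zero_mul]
    _ = mk.value I t hd j := by rw [← Finset.sum_mul, τ.sel_sum, one_mul]

theorem Follows.expectedPayoff_eq {S : mk.Strategy G} (hS : mk.Follows I t S)
    (hI : IsMeanValid G I) (h : mk.IsValid) (ht : mk.IsSelection I t) (hd : 0 < d)
    (i : Fin mk.l) (j : Fin n) :
    mk.expectedPayoff (fun _ => S) i j (S j) = mk.value I t hd j := by
  obtain ⟨hsel, hother, hpen⟩ := hS j
  calc mk.expectedPayoff (fun _ => S) i j (S j)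
      = ∑ J, (S j).sel J * mk.value I t hd j := by
        refine Finset.sum_congr rfl fun J _ => ?_
        by_cases hJ : ∃ s, J = I s
        · obtain ⟨s, rfl⟩ := hJ
          rcases (ht.nonneg s j).eq_or_lt with hj | hj
          · rw [hsel, ← hj, zero_mul, zero_mul]
          congr 1
          rw [Finset.sum_congr rfl fun a ha => (?_ : _ = mk.value I t hd j / (I s).card),
            Finset.sum_const, nsmul_eq_mul, mul_div_cancel₀ _ (hI.card_pos s).ne']
          rw [integral_congr_ae ((h.ae_mem_Icc_endpoint (ht.isOfferProfile h s)
            (mul_pos (h.q_pos j) hj) (hpen s hj a ha)).mono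
              fun x hx => hS.payoff_eq hI h ht hd ha i hj hx)]
          simp
        · rw [hother J (not_exists.1 hJ), zero_mul, zero_mul]
    _ = mk.value I t hd j := by rw [← Finset.sum_mul, (S j).sel_sum, one_mul]

/-- As the sets of the partition are disjoint, the penalty law at a node may be chosen according to
the set that contains it, whatever set is selected. -/
theorem IsSelection.exists_follows (ht : mk.IsSelection I t) (hI : IsMeanValid G I)
    (h : mk.IsValid) : ∃ S : mk.Strategy G, mk.Follows I t S := by
  choose idx hidx using hI.cover
  have hinj : Function.Injective I := fun s r hsr => by
    obtain ⟨a, ha⟩ : (I s).Nonempty := Finset.card_pos.1 (Nat.cast_pos.1 (hI.card_pos s))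
    exact hI.eq_of_mem ha (hsr ▸ ha)
  have hμ : ∀ s j, ∃ μ : ProbabilityMeasure ℝ, (∀ᵐ x ∂(μ : Measure ℝ), x ∈ mk.penaltySet j) ∧
      (0 < t s j → ∀ x, (μ : Measure ℝ).real (Set.Iic x) =
        mk.penaltyCDF (fun k => mk.q k * t s k) j x) := by
    intro s j
    have hα := ht.isOfferProfile h s
    by_cases hj : 0 < t s j
    · obtain ⟨μ, hμ⟩ := h.exists_measure_penaltyCDF hα (mul_pos (h.q_pos j) hj)
      exact ⟨μ, (h.ae_mem_Icc_endpoint hα (mul_pos (h.q_pos j) hj) hμ).mono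
        fun x hx => h.mem_penaltySet (h.Icc_endpoint_subset hα j hx), fun _ => hμ⟩
    · refine ⟨⟨Measure.dirac mk.v, inferInstance⟩, ?_, fun hj' => absurd hj' hj⟩
      change ∀ᵐ x ∂(Measure.dirac mk.v), x ∈ mk.penaltySet j
      rw [ae_dirac_eq]
      exact h.mem_penaltySet (h.v_mem_Ioc j)
  choose μ hμ1 hμ2 using hμ
  refine ⟨fun j =>
    { sel := fun J => ∑ s, if J = I s then t s j else 0
      sel_nonneg := fun J => Finset.sum_nonneg fun s _ => by
        split_ifs
        exacts [ht.nonneg s j, le_rfl]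
      sel_sum := by
        rw [Finset.sum_comm]
        simpa using (ht j).1
      sel_indep := fun J hJ => Finset.sum_eq_zero fun s _ =>
        if_neg fun e => hJ (by rw [e]; exact (hI.maximal s).1)
      pen := fun _ a => μ (idx a) j
      pen_mem := fun _ a => hμ1 (idx a) j }, fun j => ⟨fun s => ?_, fun J hJ => ?_, ?_⟩⟩
  · simp [hinj.eq_iff]
  · change ∑ s, (if J = I s then t s j else 0) = 0
    exact Finset.sum_eq_zero fun s _ => if_neg (hJ s)
  · intro s hj a ha x
    have : idx a = s := hI.eq_of_mem (hidx a) ha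
    subst this
    exact hμ2 _ j hj x

end Nash

end Market
end SpectrumGame

theorem mainTheorem1 {V : Type*} [Fintype V] [DecidableEq V] [Nonempty V] (G : SimpleGraph V)
    {d : ℕ} (I : Fin d → Finset V) (hI : SpectrumGame.IsMeanValid G I)
    {n : ℕ} (mk : SpectrumGame.Market n) (hmk : mk.IsValid) :
    (∃! t : Fin d → Fin n → ℝ, mk.IsSelection I t) ∧
      ∀ t : Fin d → Fin n → ℝ, mk.IsSelection I t →
        (∃ S : mk.Strategy G, mk.Follows I t S) ∧
          ∀ S : mk.Strategy G, mk.Follows I t S → mk.IsNash (fun _ : Fin mk.l => S) := by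
  have hd : 0 < d := by have := hI.two_le; omega
  refine ⟨?_, fun t ht => ⟨ht.exists_follows hI hmk, fun S hS i j τ => ?_⟩⟩
  · obtain ⟨t, ht⟩ := hmk.exists_isSelection hI
    exact ⟨t, ht, fun t' ht' => ht'.unique ht hmk hd hI.card_pos hI.card_antitone⟩
  · rw [hS.expectedPayoff_eq hI hmk ht hd i j]
    exact hS.expectedPayoff_le hI hmk ht hd i j τ
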